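/- For coprime integers $a,b$ let $\alpha_{a,b}\colon \mathrm{U}(1)\to\mathrm{SU}(3)$, $\alpha_{a,b}(z)=\mathrm{diag}(z^{a},z^{b},z^{-a-b})$, and let the Aloff--Wallach space $W_{a,b}=\mathrm{SU}(3)/\alpha_{a,b}(\mathrm{U}(1))$ carry its left $\mathrm{SU}(3)$-action and the smooth structure for which the projection $\mathrm{SU}(3)\to W_{a,b}$ is a submersion. For $X\in\{D^4,S^3\}$, the closed unit ball and the unit sphere in $\mathbb{C}^2$, let $X\times_{\alpha_{a,b}}\mathrm{SU}(3)$ be the quotient of $X\times\mathrm{SU}(3)$ by the $\mathrm{U}(1)$-action $z\cdot(x,g)=(zx,g\,\alpha_{a,b}(z)^{-1})$, with $\mathrm{SU}(3)$ acting by left translation on the second factor. The space $D^4\times_{\alpha_{a,b}}\mathrm{SU}(3)$ is a $D^4$-bundle over $W_{a,b}$, and its boundary $S^3\times_{\alpha_{a,b}}\mathrm{SU}(3)$ is a principal $\mathrm{SU}(3)$-bundle over $S^3/\mathrm{U}(1)=\mathbb{C}\mathrm{P}^1=S^2$. **Theorem.** Let $p_1,p_2$ be coprime integers and let $q_1,q_2$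 be coprime integers. Then there is a compact connected smooth $11$-dimensional manifold $M$ (without boundary) with a smooth action of $\mathrm{SU}(3)$ such that: 1. the action has cohomogeneity three, i.e. the minimal codimension of an orbit is $3$; 2. there are exactly two singular orbits (orbits of less than maximal dimension) $O_1\neq O_2$, and all other orbits are principal (their isotropy groups are, up to conjugacy, contained in every isotropy group of the action); 3. $O_1$ and $O_2$ are embedded submanifolds which are $\mathrm{SU}(3)$-equivariantly diffeomorphic to $W_{p_1,p_2}$ and $W_{q_1,q_2}$, respectively; 4. $M$ is obtained by gluing the disc bundles $D^4\times_{\alpha_{p_1,p_2}}\mathrm{SU}(3)$ and $D^4\times_{\alpha_{q_1,q_2}}\mathrm{SU}(3)$ along an isomorphism $S^3\times_{\alpha_{p_1,p_2}}\mathrm{SU}(3)\to S^3\times_{\alpha_{q_1,q_2}}\mathrm{SU}(3)$ of $\mathrm{SU}(3)$-bundles over $S^2$ (covering the identity), and $O_1$, $O_2$ are the zero sections of these two disc bundles. -/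

import Mathlib

open scoped Manifold ContDiff Matrix Topology

/-- The group `SU(3)`, with the subspace topology. -/
abbrev SU3 : Type := Matrix.specialUnitaryGroup (Fin 3) ℂ

namespace SU3

noncomputable section

theorem star_val_mul (g : SU3) : (g : Matrix (Fin 3) (Fin 3) ℂ)ᴴ * g.1 = 1 :=
  Matrix.mem_unitaryGroup_iff'.1 (Matrix.mem_specialUnitaryGroup_iff.1 g.2).1

theorem val_inv (g : SU3) : (g⁻¹ : SU3).1 = g.1ᴴ := rfl

theorem det_val (g : SU3) : g.1.det = 1 :=
  (Matrix.mem_specialUnitaryGroup_iff.1 g.2).2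

instance : IsTopologicalGroup SU3 where
  continuous_mul := continuous_mul
  continuous_inv := by
    refine Continuous.subtype_mk (f := fun g : SU3 => g.1ᴴ) ?_ _
    exact continuous_subtype_val.matrix_conjTranspose

/-- Coordinates on `ℝ⁸`: the traceless skew-Hermitian matrix with the given coordinates. -/
def ofCoord : EuclideanSpace ℝ (Fin 8) →ₗ[ℝ] Matrix (Fin 3) (Fin 3) ℂ where
  toFun v := !![⟨0, v 0⟩, ⟨v 2, v 3⟩, ⟨v 4, v 5⟩;
    ⟨-v 2, v 3⟩, ⟨0, v 1⟩, ⟨v 6, v 7⟩;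
    ⟨-v 4, v 5⟩, ⟨-v 6, v 7⟩, ⟨0, -v 0 - v 1⟩]
  map_add' v w := by
    ext i j
    fin_cases i <;> fin_cases j <;> apply Complex.ext <;> simp <;> ring
  map_smul' c v := by
    ext i j
    fin_cases i <;> fin_cases j <;> apply Complex.ext <;> simp <;> ring

/-- The coordinates in `ℝ⁸` of the traceless skew-Hermitian part of a matrix. -/
def coord : Matrix (Fin 3) (Fin 3) ℂ →ₗ[ℝ] EuclideanSpace ℝ (Fin 8) where
  toFun X := !₂[(X 0 0).im - X.trace.im / 3, (X 1 1).im - X.trace.im / 3,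
    ((X 0 1).re - (X 1 0).re) / 2, ((X 0 1).im + (X 1 0).im) / 2,
    ((X 0 2).re - (X 2 0).re) / 2, ((X 0 2).im + (X 2 0).im) / 2,
    ((X 1 2).re - (X 2 1).re) / 2, ((X 1 2).im + (X 2 1).im) / 2]
  map_add' X Y := by
    ext i
    fin_cases i <;> simp [Matrix.trace_fin_three] <;> ring
  map_smul' c X := by
    ext i
    fin_cases i <;> simp [Matrix.trace_fin_three] <;> ring

theorem coord_ofCoord (v : EuclideanSpace ℝ (Fin 8)) : coord (ofCoord v) = v := by
  ext i
  fin_cases i <;> simp [coord, ofCoord, Matrix.trace_fin_three]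

/-- A smooth self-map of the `3 × 3` matrices whose derivative at `1` is the identity and
which straightens `SU(3)` near `1` to the space of traceless skew-Hermitian matrices. -/
def straighten (X : Matrix (Fin 3) (Fin 3) ℂ) : Matrix (Fin 3) (Fin 3) ℂ :=
  ofCoord (coord X) + (1 / 2 : ℝ) • (Xᴴ * X - 1) +
    (X.det.im / 3 : ℝ) • (Complex.I • (1 : Matrix (Fin 3) (Fin 3) ℂ))

theorem coord_straighten (X : Matrix (Fin 3) (Fin 3) ℂ) : coord (straighten X) = coord X := by
  have h1 : coord (Xᴴ * X - 1) = 0 := by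
    ext i
    fin_cases i <;>
      simp [coord, Matrix.trace_fin_three, Matrix.mul_apply, Fin.sum_univ_three] <;> ring
  have h2 : coord (Complex.I • (1 : Matrix (Fin 3) (Fin 3) ℂ)) = 0 := by
    ext i
    fin_cases i <;> simp [coord, Matrix.trace_fin_three] <;> norm_num
  simp only [straighten, map_add, map_smul, h1, h2, coord_ofCoord, smul_zero, add_zero]

theorem straighten_val (g : SU3) : straighten g.1 = ofCoord (coord g.1) := by
  simp [straighten, star_val_mul, det_val]

theorem mem_of_straighten {X : Matrix (Fin 3) (Fin 3) ℂ} (hX : 0 < X.det.re)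
    {v : EuclideanSpace ℝ (Fin 8)} (h : straighten X = ofCoord v) :
    X ∈ Matrix.specialUnitaryGroup (Fin 3) ℂ := by
  have hv : coord X = v := by rw [← coord_straighten, h, coord_ofCoord]
  have h0 : (1 / 2 : ℝ) • (Xᴴ * X - 1) +
      (X.det.im / 3 : ℝ) • (Complex.I • (1 : Matrix (Fin 3) (Fin 3) ℂ)) = 0 := by
    have := h
    rw [straighten, hv, add_assoc] at this
    simpa using this
  have h1 : Xᴴ * X = 1 := by
    have hc := congrArg Matrix.conjTranspose h0
    have e : (Complex.I • (1 : Matrix (Fin 3) (Fin 3) ℂ))ᴴ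
        = -(Complex.I • (1 : Matrix (Fin 3) (Fin 3) ℂ)) := by simp
    have hh : (Xᴴ * X - 1)ᴴ = Xᴴ * X - 1 := by
      simp [Matrix.conjTranspose_sub, Matrix.conjTranspose_mul]
    rw [Matrix.conjTranspose_add, Matrix.conjTranspose_smul, Matrix.conjTranspose_smul, e, hh] at hc
    simp only [star_trivial, Matrix.conjTranspose_zero] at hc
    have hs : Xᴴ * X - 1 = 0 := by
      calc Xᴴ * X - 1 = ((1 / 2 : ℝ) • (Xᴴ * X - 1) +
            (X.det.im / 3 : ℝ) • (Complex.I • (1 : Matrix (Fin 3) (Fin 3) ℂ))) +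
            ((1 / 2 : ℝ) • (Xᴴ * X - 1) +
            (X.det.im / 3 : ℝ) • -(Complex.I • (1 : Matrix (Fin 3) (Fin 3) ℂ))) := by module
        _ = 0 := by rw [h0, hc, add_zero]
    exact sub_eq_zero.1 hs
  have h2 : X.det.im = 0 := by
    rw [h1, sub_self, smul_zero, zero_add] at h0
    have := congrArg Complex.im (congrFun (congrFun h0 0) 0)
    simpa using this
  have h3 : star X.det * X.det = 1 := by
    have := congrArg Matrix.det h1
    rwa [Matrix.det_mul, Matrix.det_conjTranspose, Matrix.det_one] at this
  refine Matrix.mem_specialUnitaryGroup_iff.2 ⟨Matrix.mem_unitaryGroup_iff'.2 h1, ?_⟩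
  have h4 := congrArg Complex.re h3
  simp [h2] at h4
  apply Complex.ext
  · simp; nlinarith
  · simpa using h2

/-- The space of `3 × 3` matrices as a normed space (with the supremum norm). -/
abbrev Amb : Type := Fin 3 → Fin 3 → ℂ

/-- The inclusion of `SU(3)` into the space of matrices. -/
def val (g : SU3) : Amb := fun i j => g.1 i j

theorem of_val (g : SU3) : Matrix.of (val g) = g.1 := rfl

theorem isInducing_val : Topology.IsInducing val := Topology.IsInducing.subtypeVal

theorem continuous_val : Continuous val := isInducing_val.continuous

/-- `straighten` on the normed space of matrices. -/
def str (X : Amb) : Amb := fun i j => straighten (Matrix.of X) i j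

def coordA : Amb →L[ℝ] EuclideanSpace ℝ (Fin 8) :=
  LinearMap.toContinuousLinearMap
    { toFun := fun X => coord (Matrix.of X)
      map_add' := fun X Y => coord.map_add (Matrix.of X) (Matrix.of Y)
      map_smul' := fun c X => coord.map_smul c (Matrix.of X) }

def ofCoordA : EuclideanSpace ℝ (Fin 8) →L[ℝ] Amb :=
  LinearMap.toContinuousLinearMap
    { toFun := fun v i j => ofCoord v i j
      map_add' := fun v w => ofCoord.map_add v w
      map_smul' := fun c v => ofCoord.map_smul c v }

def mulA (X : Matrix (Fin 3) (Fin 3) ℂ) : Amb →L[ℝ] Amb :=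
  LinearMap.toContinuousLinearMap
    { toFun := fun Y i j => (X * Matrix.of Y) i j
      map_add' := fun Y Z => mul_add X (Matrix.of Y) (Matrix.of Z)
      map_smul' := fun c Y => mul_smul_comm c X (Matrix.of Y) }

theorem contDiff_entry (i j : Fin 3) : ContDiff ℝ ∞ (fun X : Amb => X i j) := by
  fun_prop

theorem contDiff_det : ContDiff ℝ ∞ (fun X : Amb => (Matrix.of X).det) := by
  simp only [Matrix.det_fin_three, Matrix.of_apply]
  fun_prop

theorem contDiff_str : ContDiff ℝ ∞ str := by
  have h1 : ContDiff ℝ ∞ (fun X => ofCoordA (coordA X)) := (ofCoordA.comp coordA).contDiff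
  refine contDiff_pi.2 fun i => contDiff_pi.2 fun j => ?_
  have h1' : ContDiff ℝ ∞ (fun X : Amb => ofCoord (coord (Matrix.of X)) i j) :=
    contDiff_pi.1 (contDiff_pi.1 h1 i) j
  have h2 : ContDiff ℝ ∞ (fun X : Amb => ((Matrix.of X)ᴴ * Matrix.of X - 1) i j) := by
    simp only [Matrix.sub_apply, Matrix.mul_apply, Matrix.conjTranspose_apply, Matrix.of_apply]
    refine ContDiff.sub (ContDiff.sum fun k _ => ContDiff.mul ?_ (contDiff_entry k j))
      contDiff_const
    exact Complex.conjCLE.contDiff.comp (contDiff_entry k i)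
  have h3 : ContDiff ℝ ∞ (fun X : Amb => (Matrix.of X).det.im / 3) :=
    (Complex.imCLM.contDiff.comp contDiff_det).div_const 3
  exact (h1'.add (h2.const_smul (1 / 2 : ℝ))).add (h3.smul contDiff_const)

theorem ofCoord_coord_add (v : Matrix (Fin 3) (Fin 3) ℂ) :
    ofCoord (coord v) + (1 / 2 : ℝ) • (vᴴ + v) +
      (v.trace.im / 3 : ℝ) • (Complex.I • (1 : Matrix (Fin 3) (Fin 3) ℂ)) = v := by
  ext i j
  fin_cases i <;> fin_cases j <;> apply Complex.ext <;>
    simp [coord, ofCoord, Matrix.trace_fin_three] <;> ring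

theorem hasDerivAt_det (v : Matrix (Fin 3) (Fin 3) ℂ) :
    HasDerivAt (fun t : ℝ => (1 + t • v).det) v.trace 0 := by
  have h : (fun t : ℝ => (1 + t • v).det) = fun t : ℝ => 1 + v.trace * (t : ℂ) +
      Polynomial.eval (t : ℂ) (Matrix.det
        (1 + (Polynomial.X : Polynomial ℂ) • v.map Polynomial.C)).divX.divX * (t : ℂ) ^ 2 := by
    funext t
    rw [← Matrix.det_one_add_smul]
    rfl
  rw [h]
  have hd : HasDerivAt (fun z : ℂ => 1 + v.trace * z +
      Polynomial.eval z (Matrix.det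
        (1 + (Polynomial.X : Polynomial ℂ) • v.map Polynomial.C)).divX.divX * z ^ 2)
      v.trace ((0 : ℝ) : ℂ) := by
    have h1 := ((hasDerivAt_id ((0 : ℝ) : ℂ)).const_mul v.trace).const_add 1
    have h2 := ((Matrix.det
        (1 + (Polynomial.X : Polynomial ℂ) • v.map Polynomial.C)).divX.divX.hasDerivAt
          ((0 : ℝ) : ℂ)).mul ((hasDerivAt_id ((0 : ℝ) : ℂ)).pow 2)
    have h3 := h1.add h2
    exact h3.congr_deriv (by simp)
  exact hd.comp_ofReal

theorem straighten_line (v : Matrix (Fin 3) (Fin 3) ℂ) (t : ℝ) :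
    straighten (1 + t • v) = straighten 1 + t • v + t ^ 2 • ((1 / 2 : ℝ) • (vᴴ * v)) +
      (((1 + t • v).det.im - t * v.trace.im) / 3 : ℝ) •
        (Complex.I • (1 : Matrix (Fin 3) (Fin 3) ℂ)) := by
  have hv : straighten (1 + t • v) = straighten 1 + t • (ofCoord (coord v) +
      (1 / 2 : ℝ) • (vᴴ + v) + (v.trace.im / 3 : ℝ) •
        (Complex.I • (1 : Matrix (Fin 3) (Fin 3) ℂ))) + t ^ 2 • ((1 / 2 : ℝ) • (vᴴ * v)) +
      (((1 + t • v).det.im - t * v.trace.im) / 3 : ℝ) •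
        (Complex.I • (1 : Matrix (Fin 3) (Fin 3) ℂ)) := by
    simp only [straighten, map_add, map_smul, Matrix.conjTranspose_add, Matrix.conjTranspose_one,
      Matrix.conjTranspose_smul, star_trivial, add_mul, mul_add, one_mul, mul_one, smul_mul_assoc,
      mul_smul_comm, Matrix.det_one, Complex.one_im]
    module
  rwa [ofCoord_coord_add] at hv

theorem hasFDerivAt_str :
    HasFDerivAt str ((ContinuousLinearEquiv.refl ℝ Amb : Amb ≃L[ℝ] Amb) : Amb →L[ℝ] Amb)
      (val 1) := by
  have hF := (contDiff_str.differentiable (by simp)).differentiableAt.hasFDerivAt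
    (x := val 1)
  have key : (ContinuousLinearEquiv.refl ℝ Amb : Amb →L[ℝ] Amb) = fderiv ℝ str (val 1) := by
    refine ContinuousLinearMap.ext fun v => ?_
    have hl : HasDerivAt (fun t : ℝ => val 1 + t • v) v 0 := by
      simpa using ((hasDerivAt_id (0 : ℝ)).smul_const v).const_add (val 1)
    have hA : HasDerivAt (fun t : ℝ => str (val 1 + t • v)) (fderiv ℝ str (val 1) v) 0 :=
      HasFDerivAt.comp_hasDerivAt (x := (0 : ℝ)) (l := str)
        (f := fun t : ℝ => val 1 + t • v) (by simpa using hF) hl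
    have hB : HasDerivAt (fun t : ℝ => str (val 1 + t • v)) v 0 := by
      refine hasDerivAt_pi.2 fun i => hasDerivAt_pi.2 fun j => ?_
      have e : (fun t : ℝ => str (val 1 + t • v) i j) = fun t : ℝ =>
          straighten 1 i j + t • v i j +
            t ^ 2 • ((1 / 2 : ℝ) • ((Matrix.of v)ᴴ * Matrix.of v) i j) +
            (((1 + t • Matrix.of v).det.im - t * (Matrix.of v).trace.im) / 3 : ℝ) •
              (Complex.I • (1 : Matrix (Fin 3) (Fin 3) ℂ)) i j := by
        funext t
        exact congrFun (congrFun (straighten_line (Matrix.of v) t) i) j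
      rw [e]
      have h1 := ((hasDerivAt_id (0 : ℝ)).smul_const (v i j)).const_add (straighten 1 i j)
      have h2 := (hasDerivAt_pow 2 (0 : ℝ)).smul_const
        ((1 / 2 : ℝ) • ((Matrix.of v)ᴴ * Matrix.of v) i j)
      have h3 := (((Complex.imCLM.hasFDerivAt.comp_hasDerivAt 0
        (hasDerivAt_det (Matrix.of v))).sub ((hasDerivAt_id (0 : ℝ)).mul_const
          (Matrix.of v).trace.im)).div_const 3).smul_const
            ((Complex.I • (1 : Matrix (Fin 3) (Fin 3) ℂ)) i j)
      exact ((h1.add h2).add h3).congr_deriv (by simp)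
    exact hB.unique hA
  rw [key]
  exact hF

/-- The restriction of `str` to a neighbourhood of `1` on which it is a diffeomorphism. -/
def strChart : OpenPartialHomeomorph Amb Amb :=
  ((contDiff_str.contDiffAt (x := val 1)).toOpenPartialHomeomorph str
    hasFDerivAt_str (by simp)).restr
    ({X | 0 < (Matrix.of X).det.re} ∩ fderiv ℝ str ⁻¹'
      Set.range ((↑) : (Amb ≃L[ℝ] Amb) → (Amb →L[ℝ] Amb)))

theorem strChart_coe : (strChart : Amb → Amb) = str := rfl

theorem isOpen_restr : IsOpen ({X : Amb | 0 < (Matrix.of X).det.re} ∩ fderiv ℝ str ⁻¹'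
      Set.range ((↑) : (Amb ≃L[ℝ] Amb) → (Amb →L[ℝ] Amb))) :=
  (isOpen_lt continuous_const (Complex.continuous_re.comp contDiff_det.continuous)).inter
    (ContinuousLinearEquiv.isOpen.preimage (contDiff_str.continuous_fderiv (by simp)))

theorem mem_strChart_source {X : Amb} (hX : X ∈ strChart.source) :
    0 < (Matrix.of X).det.re ∧ ∃ L : Amb ≃L[ℝ] Amb, (L : Amb →L[ℝ] Amb) = fderiv ℝ str X := by
  rw [strChart, OpenPartialHomeomorph.restr_source, isOpen_restr.interior_eq] at hX
  exact hX.2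

theorem val_one_mem_source : val 1 ∈ strChart.source := by
  rw [strChart, OpenPartialHomeomorph.restr_source, isOpen_restr.interior_eq]
  refine ⟨ContDiffAt.mem_toOpenPartialHomeomorph_source _ _ _, ?_, ?_⟩
  · change 0 < (Matrix.of (val 1)).det.re
    rw [of_val, det_val]
    simp
  · exact ⟨ContinuousLinearEquiv.refl ℝ _, hasFDerivAt_str.fderiv.symm⟩

theorem contDiffOn_symm : ContDiffOn ℝ ∞ strChart.symm strChart.target := by
  intro A hA
  obtain ⟨-, L, hL⟩ := mem_strChart_source (strChart.map_target hA)
  refine (strChart.contDiffAt_symm hA (f₀' := L) ?_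
    contDiff_str.contDiffAt).contDiffWithinAt
  rw [hL]
  exact (contDiff_str.differentiable (by simp)).differentiableAt.hasFDerivAt

theorem str_val (g : SU3) : str (val g) = ofCoordA (coordA (val g)) :=
  straighten_val g

theorem symm_mem {v : EuclideanSpace ℝ (Fin 8)} (hv : ofCoordA v ∈ strChart.target) :
    Matrix.of (strChart.symm (ofCoordA v)) ∈ Matrix.specialUnitaryGroup (Fin 3) ℂ :=
  mem_of_straighten (mem_strChart_source (strChart.map_target hv)).1
    (v := v) (strChart.right_inv hv)

open Classical in
/-- The inverse of the chart of `SU(3)` at `1`. -/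
def chartOneInv (v : EuclideanSpace ℝ (Fin 8)) : SU3 :=
  if hv : ofCoordA v ∈ strChart.target then
    ⟨Matrix.of (strChart.symm (ofCoordA v)), symm_mem hv⟩ else 1

theorem val_chartOneInv {v : EuclideanSpace ℝ (Fin 8)} (hv : ofCoordA v ∈ strChart.target) :
    val (chartOneInv v) = strChart.symm (ofCoordA v) := by
  rw [chartOneInv, dif_pos hv]
  rfl

theorem val_injective : Function.Injective val := fun _ _ h => Subtype.ext h

/-- The chart of `SU(3)` at `1`: the coordinates of the traceless skew-Hermitian part. -/
def chartOne : OpenPartialHomeomorph SU3 (EuclideanSpace ℝ (Fin 8)) where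
  toFun g := coordA (val g)
  invFun := chartOneInv
  source := val ⁻¹' strChart.source
  target := ofCoordA ⁻¹' strChart.target
  map_source' g hg := by
    have := strChart.map_source hg
    rwa [strChart_coe, str_val] at this
  map_target' v hv := by
    rw [Set.mem_preimage, val_chartOneInv hv]
    exact strChart.map_target hv
  left_inv' g hg := by
    have h1 := strChart.map_source hg
    have h2 := strChart.left_inv hg
    rw [strChart_coe, str_val] at h1 h2
    exact val_injective ((val_chartOneInv h1).trans h2)
  right_inv' v hv := by
    have h : str (strChart.symm (ofCoordA v)) = ofCoordA v := strChart.right_inv hv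
    rw [val_chartOneInv hv]
    calc coordA (strChart.symm (ofCoordA v)) = coordA (str (strChart.symm (ofCoordA v))) :=
          (coord_straighten _).symm
      _ = v := by rw [h]; exact coord_ofCoord v
  open_source := strChart.open_source.preimage continuous_val
  open_target := strChart.open_target.preimage ofCoordA.continuous
  continuousOn_toFun := (coordA.continuous.comp continuous_val).continuousOn
  continuousOn_invFun := by
    rw [isInducing_val.continuousOn_iff]
    have : ContinuousOn (fun v => strChart.symm (ofCoordA v)) (ofCoordA ⁻¹' strChart.target) :=
      strChart.continuousOn_symm.comp ofCoordA.continuous.continuousOn fun _ h => h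
    exact this.congr fun v hv => val_chartOneInv hv

/-- The translate to `g` of the chart at `1`. -/
def chart (g : SU3) : OpenPartialHomeomorph SU3 (EuclideanSpace ℝ (Fin 8)) :=
  (Homeomorph.mulLeft g⁻¹).toOpenPartialHomeomorph ≫ₕ chartOne

/-- The smooth structure of `SU(3)` as a submanifold of the space of matrices. -/
instance : ChartedSpace (EuclideanSpace ℝ (Fin 8)) SU3 where
  atlas := Set.range chart
  chartAt := chart
  mem_chart_source g := by
    simp only [chart, OpenPartialHomeomorph.trans_source,
      Homeomorph.toOpenPartialHomeomorph_source, Homeomorph.toOpenPartialHomeomorph_apply,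
      Set.univ_inter, Set.mem_preimage, Homeomorph.coe_mulLeft, inv_mul_cancel]
    exact val_one_mem_source
  chart_mem_atlas g := ⟨g, rfl⟩

theorem chart_apply (g h : SU3) : chart g h = coordA (mulA g.1ᴴ (val h)) := rfl

theorem chart_target (g : SU3) : (chart g).target = ofCoordA ⁻¹' strChart.target := by
  simp [chart, chartOne]

theorem val_chart_symm (g : SU3) {v : EuclideanSpace ℝ (Fin 8)} (hv : v ∈ (chart g).target) :
    val ((chart g).symm v) = mulA g.1 (strChart.symm (ofCoordA v)) := by
  rw [chart_target] at hv
  rw [← val_chartOneInv hv]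
  have : (chart g).symm v = g * chartOneInv v := by
    change (g⁻¹)⁻¹ * chartOneInv v = _
    rw [inv_inv]
  rw [this]
  rfl

theorem contDiffOn_chart_symm (g : SU3) :
    ContDiffOn ℝ ∞ (fun v => val ((chart g).symm v)) (chart g).target := by
  have h : ContDiffOn ℝ ∞ (fun v => mulA g.1 (strChart.symm (ofCoordA v)))
      (chart g).target := by
    refine (mulA g.1).contDiff.comp_contDiffOn (contDiffOn_symm.comp
      ofCoordA.contDiff.contDiffOn fun v hv => ?_)
    rwa [chart_target] at hv
  exact h.congr fun v hv => val_chart_symm g hv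

theorem contDiff_coord_mul (X : Matrix (Fin 3) (Fin 3) ℂ) :
    ContDiff ℝ ∞ (fun Y => coordA (mulA X Y)) :=
  coordA.contDiff.comp (mulA X).contDiff

instance : IsManifold (𝓡 8) ∞ SU3 := by
  refine isManifold_of_contDiffOn _ _ _ ?_
  rintro _ _ ⟨g, rfl⟩ ⟨h, rfl⟩
  have := (contDiff_coord_mul h.1ᴴ).comp_contDiffOn (contDiffOn_chart_symm g)
  simp only [mfld_simps]
  refine this.mono fun v hv => ?_
  simp only [mfld_simps] at hv
  exact hv.1

/-- The inclusion of `SU(3)` into the `3 × 3` matrices is smooth. -/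
theorem contMDiff_val : ContMDiff (𝓡 8) 𝓘(ℝ, Amb) ∞ val := by
  intro g
  rw [contMDiffAt_iff]
  refine ⟨continuous_val.continuousAt, ?_⟩
  have h := (contDiffOn_chart_symm g).contDiffAt
    ((chart g).open_target.mem_nhds ((chart g).map_source (mem_chart_source _ g)))
  exact h.contDiffWithinAt

/-- A map into `SU(3)` is smooth if it is smooth as a map into the `3 × 3` matrices. -/
theorem contMDiff_of_val {E H N : Type*} [NormedAddCommGroup E] [NormedSpace ℝ E]
    [TopologicalSpace H] {I : ModelWithCorners ℝ E H} [TopologicalSpace N] [ChartedSpace H N]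
    {f : N → SU3} (hf : ContMDiff I 𝓘(ℝ, Amb) ∞ (fun x => val (f x))) :
    ContMDiff I (𝓡 8) ∞ f := by
  intro x
  rw [contMDiffAt_iff_target]
  refine ⟨(isInducing_val.continuous_iff.2 hf.continuous).continuousAt, ?_⟩
  exact ((contDiff_coord_mul (f x).1ᴴ).contMDiff.comp hf) x

instance : LieGroup (𝓡 8) ∞ SU3 where
  contMDiff_mul := by
    refine contMDiff_of_val ?_
    have h1 : ContMDiff ((𝓡 8).prod (𝓡 8)) 𝓘(ℝ, Amb) ∞ (fun p : SU3 × SU3 => val p.1) :=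
      contMDiff_val.comp contMDiff_fst
    have h2 : ContMDiff ((𝓡 8).prod (𝓡 8)) 𝓘(ℝ, Amb) ∞ (fun p : SU3 × SU3 => val p.2) :=
      contMDiff_val.comp contMDiff_snd
    have hm : ContDiff ℝ ∞ (fun p : Amb × Amb => fun i j => ∑ k, p.1 i k * p.2 k j) := by
      fun_prop
    exact hm.contMDiff.comp (h1.prodMk_space h2)
  contMDiff_inv := by
    refine contMDiff_of_val ?_
    have hm : ContDiff ℝ ∞ (fun X : Amb => fun i j => Complex.conjCLE (X j i)) := by
      fun_prop
    exact hm.contMDiff.comp contMDiff_val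

end

end SU3

/-- The homomorphism `U(1) → SU(3)`, `z ↦ diag(z^p, z^q, z^(-p-q))`. -/
noncomputable def torusHom (p q : ℤ) : Circle →* SU3 where
  toFun z := ⟨Matrix.diagonal ![((z ^ p : Circle) : ℂ), ((z ^ q : Circle) : ℂ),
    ((z ^ (-p - q) : Circle) : ℂ)], by
      rw [Matrix.mem_specialUnitaryGroup_iff]
      constructor
      · rw [Matrix.mem_unitaryGroup_iff, Matrix.star_eq_conjTranspose,
          Matrix.diagonal_conjTranspose, Matrix.diagonal_mul_diagonal, ← Matrix.diagonal_one]
        congr 1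
        funext i
        fin_cases i <;> simp [← Circle.coe_inv_eq_conj, -Circle.coe_zpow]
      · rw [Matrix.det_diagonal, Fin.prod_univ_three]
        change ((z ^ p : Circle) : ℂ) * ((z ^ q : Circle) : ℂ) * ((z ^ (-p - q) : Circle) : ℂ) = 1
        rw [← Circle.coe_mul, ← Circle.coe_mul, ← zpow_add, ← zpow_add]
        simp⟩
  map_one' := by
    apply Subtype.ext
    ext i j
    fin_cases i <;> fin_cases j <;> simp
  map_mul' z w := by
    apply Subtype.ext
    change Matrix.diagonal _ = Matrix.diagonal _ * Matrix.diagonal _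
    rw [Matrix.diagonal_mul_diagonal]
    congr 1
    funext i
    fin_cases i <;> simp [mul_zpow]

/-- The Aloff–Wallach space `W_{p,q}`, the space of left cosets of the image of `torusHom p q`,
with the quotient topology and the action of `SU(3)` by left translation. -/
abbrev AloffWallach (p q : ℤ) : Type := SU3 ⧸ (torusHom p q).range

section GManifold

variable {E H E' H' : Type*} [NormedAddCommGroup E] [NormedSpace ℝ E] [TopologicalSpace H]
  [NormedAddCommGroup E'] [NormedSpace ℝ E'] [TopologicalSpace H']
  (I : ModelWithCorners ℝ E H) (J : ModelWithCorners ℝ E' H')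
  (G : Type*) [TopologicalSpace G] [ChartedSpace H G] [Group G]
  {M : Type*} [TopologicalSpace M] [ChartedSpace H' M] [MulAction G M]

/-- The tangent space at `m` to the orbit of `m`, for a smooth action of a Lie group: the image
of the differential at `1` of the orbit map `g ↦ g • m`. -/
noncomputable def orbitTangent (m : M) : Submodule ℝ (TangentSpace J ((1 : G) • m)) :=
  LinearMap.range (mfderiv I J (fun g : G => g • m) 1).toLinearMap

/-- The dimension of the orbit of `m`. -/
noncomputable def orbitDim (m : M) : ℕ :=
  Module.finrank ℝ (orbitTangent I J G m)

/-- The codimension of the orbit of `m`. -/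
noncomputable def orbitCodim (m : M) : ℕ :=
  Module.finrank ℝ (TangentSpace J ((1 : G) • m) ⧸ orbitTangent I J G m)

variable (M) in
/-- The cohomogeneity of a smooth action is the smallest codimension of an orbit. -/
def HasCohomogeneity (k : ℕ) : Prop :=
  IsLeast (Set.range fun m : M => orbitCodim I J G m) k

/-- An orbit is principal if its isotropy groups are, up to conjugacy, contained in all
isotropy groups of the action. -/
def IsPrincipalOrbit (O : Set M) : Prop :=
  ∃ m : M, O = MulAction.orbit G m ∧
    ∀ m' : M, ∃ g : G, MulAction.stabilizer G (g • m) ≤ MulAction.stabilizer G m'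

/-- An orbit is singular if its dimension is not the maximal dimension of an orbit. -/
def IsSingularOrbit (O : Set M) : Prop :=
  ∃ m : M, O = MulAction.orbit G m ∧ ∃ m' : M, orbitDim I J G m < orbitDim I J G m'

end GManifold

section

variable {M : Type*} [TopologicalSpace M] [ChartedSpace (EuclideanSpace ℝ (Fin 11)) M]
  [MulAction SU3 M]

/-- The subset `O` of `M` is `SU(3)`-equivariantly diffeomorphic to `W_{p,q}`: for the smooth
structure on `W_{p,q}` that makes the projection from `SU(3)` a submersion, it is the image of an
equivariant smooth embedding of `W_{p,q}`. -/
def IsAloffWallachOrbit (p q : ℤ) (O : Set M) : Prop :=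
  ∃ _ : ChartedSpace (EuclideanSpace ℝ (Fin 7)) (AloffWallach p q),
    IsManifold (𝓡 7) ∞ (AloffWallach p q) ∧
    Manifold.IsSubmersion (𝓡 8) (𝓡 7) ∞ (QuotientGroup.mk : SU3 → AloffWallach p q) ∧
    ∃ f : AloffWallach p q → M, Manifold.IsSmoothEmbedding (𝓡 7) (𝓡 11) ∞ f ∧
      (∀ (g : SU3) (w : AloffWallach p q), f (g • w) = g • f w) ∧ Set.range f = O

end

/-- The Hermitian space `ℂ²`. -/
abbrev C2 : Type := EuclideanSpace ℂ (Fin 2)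

/-- The orbit relation of the action `z · (x, g) = (z x, g α(z)⁻¹)` of `U(1)` on
`ℂ² × SU(3)`; the action is free if `α` is injective. -/
def assocSetoid (α : Circle →* SU3) : Setoid (C2 × SU3) where
  r a b := ∃ z : Circle, b = ((z : ℂ) • a.1, a.2 * (α z)⁻¹)
  iseqv := by
    refine ⟨fun a => ⟨1, by simp⟩, ?_, ?_⟩
    · rintro a _ ⟨z, rfl⟩
      exact ⟨z⁻¹, by simp [smul_smul]⟩
    · rintro a _ _ ⟨z, rfl⟩ ⟨w, rfl⟩
      exact ⟨w * z, by simp [smul_smul, mul_assoc]⟩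

/-- The space `ℂ² ×_α SU(3)`; for injective `α` it is a `ℂ²`-bundle over `SU(3) / α(U(1))`. -/
def AssocBundle (α : Circle →* SU3) : Type := Quotient (assocSetoid α)

namespace AssocBundle

variable (α β : Circle →* SU3)

/-- The projection `ℂ² × SU(3) → ℂ² ×_α SU(3)`. -/
def mk (a : C2 × SU3) : AssocBundle α := Quotient.mk (assocSetoid α) a

instance : TopologicalSpace (AssocBundle α) :=
  inferInstanceAs (TopologicalSpace (Quotient (assocSetoid α)))

/-- `SU(3)` acts by left translation on the second factor. -/
instance : MulAction SU3 (AssocBundle α) where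
  smul g := Quotient.map (fun a => (a.1, g * a.2)) (by
    rintro a _ ⟨z, rfl⟩
    exact ⟨z, by simp [mul_assoc]⟩)
  one_smul := by
    rintro ⟨a⟩
    exact congrArg (mk α) (by simp)
  mul_smul := by
    rintro g h ⟨a⟩
    exact congrArg (mk α) (by simp [mul_assoc])

theorem smul_mk (g : SU3) (a : C2 × SU3) : g • mk α a = mk α (a.1, g * a.2) := rfl

/-- The zero section, the orbit `SU(3) / α(U(1))`. -/
def zeroSection : Set (AssocBundle α) := mk α '' {a | a.1 = 0}

/-- The disc bundle `D⁴ ×_α SU(3)`. -/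
def disc : Set (AssocBundle α) := mk α '' {a | ‖a.1‖ ≤ 1}

/-- The sphere bundle `S³ ×_α SU(3)`, which is also a principal `SU(3)`-bundle over
`S³ / U(1) = ℂP¹ = S²`, with projection `[x, g] ↦ [x]`. -/
def sphere : Set (AssocBundle α) := mk α '' {a | ‖a.1‖ = 1}

/-- An isomorphism `S³ ×_α SU(3) → S³ ×_β SU(3)` of `SU(3)`-bundles over `ℂP¹`: an equivariant
homeomorphism that covers the identity of `ℂP¹`. -/
structure SphereIso where
  toHomeomorph : sphere α ≃ₜ sphere β
  map_smul : ∀ (g : SU3) (b b' : sphere α), (b' : AssocBundle α) = g • (b : AssocBundle α) →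
    (toHomeomorph b' : AssocBundle β) = g • (toHomeomorph b : AssocBundle β)
  covers_id : ∀ (b : sphere α) (x : C2) (g : SU3), (b : AssocBundle α) = mk α (x, g) →
    ∃ h : SU3, (toHomeomorph b : AssocBundle β) = mk β (x, h)

variable {M : Type*} [TopologicalSpace M] [ChartedSpace (EuclideanSpace ℝ (Fin 11)) M]
  [MulAction SU3 M]

variable {α} in
/-- `j` is an equivariant diffeomorphism of `ℂ² ×_α SU(3)` onto an open subset of `M`. For
injective `α`, `ℂ² ×_α SU(3)` is the quotient of `ℂ² × SU(3)` by a free action of `U(1)`, so this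
means that `j` is injective and that its lift to `ℂ² × SU(3)` is a submersion. -/
structure IsTube (j : AssocBundle α → M) : Prop where
  injective : Function.Injective j
  map_smul : ∀ (g : SU3) (b : AssocBundle α), j (g • b) = g • j b
  isSubmersion : Manifold.IsSubmersion (𝓘(ℝ, C2).prod (𝓡 8)) (𝓡 11) ∞ (j ∘ mk α)

/-- `M` is obtained by gluing the disc bundles `D⁴ ×_α SU(3)` and `D⁴ ×_β SU(3)` along an
isomorphism `S³ ×_α SU(3) → S³ ×_β SU(3)` of `SU(3)`-bundles over `ℂP¹`, and `O₁`, `O₂` are the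
zero sections of these bundles. -/
def IsGluing (O₁ O₂ : Set M) : Prop :=
  ∃ (j₁ : AssocBundle α → M) (j₂ : AssocBundle β → M) (φ : SphereIso α β),
    IsTube j₁ ∧ IsTube j₂ ∧ j₁ '' zeroSection α = O₁ ∧ j₂ '' zeroSection β = O₂ ∧
    j₁ '' disc α ∪ j₂ '' disc β = Set.univ ∧
    j₁ '' disc α ∩ j₂ '' disc β = j₁ '' sphere α ∧
    ∀ b : sphere α, j₁ b = j₂ (φ.toHomeomorph b)

end AssocBundle

/-!
Let `α = α_{p,q}`. There is a smooth map `f : ℂ² \ {0} → SU(3)` with `f (z x) = α z * f x`: a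
product of two `SU(2)`-blocks whose first rows are normalized vectors with entries of weights
`(p, p)` and `(p + q, q)` in the coordinates of `x`. This is an explicit form of the triviality of
`SU(3)`-bundles over `S²`. The equivariant map `[x, g] ↦ ([x], g * f x)` then identifies the
complement of the zero section of `ℂ² ×_α SU(3)` with `(ℂ² \ {0}) / U(1) × SU(3)`, a space that
does not depend on `α`. Two such bundles, for `α` and `β`, are glued along the inversion
`x ↦ x / ‖x‖²` in these trivializations. The inversion exchanges the inside and the outside of the
unit disc bundle and fixes the sphere bundle, so the result is a closed manifold, the union of the
two disc bundles along their boundaries. Off the zero sections `SU(3)` acts freely, with orbits of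
codimension `3`; each zero section is a single orbit `SU(3) / α(U(1))`, of dimension at most `7`.

The smooth structure on `ℂ² ×_α SU(3)`, and on `SU(3) / α(U(1))`, comes from flow boxes for the free
circle action. These rest on circle-valued functions of weight one: on the diagonal entries of `g`
the circle acts with weights `p` and `q`, so by Bézout a monomial in their directions has
weight one.
-/

/-! ### Topology of the special unitary groups -/

section SpecialUnitary

variable {n : Type*} [Fintype n] [DecidableEq n]

theorem isCompact_unitaryGroup : IsCompact (Matrix.unitaryGroup n ℂ : Set (Matrix n n ℂ)) := by
  refine IsCompact.of_isClosed_subset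
    (isCompact_univ_pi fun _ => isCompact_univ_pi fun _ => isCompact_closedBall (0 : ℂ) 1)
    isClosed_unitary fun A hA i _ j _ => ?_
  exact mem_closedBall_zero_iff.2 (entry_norm_bound_of_unitary hA i j)

instance : CompactSpace (Matrix.specialUnitaryGroup n ℂ) :=
  isCompact_iff_compactSpace.1 <| isCompact_unitaryGroup.inter_right <|
    isClosed_singleton.preimage (continuous_id.matrix_det (R := ℂ))

theorem coe_circle_mem_unitary (z : Circle) : (z : ℂ) ∈ unitary ℂ := by
  have h : star (z : ℂ) * z = 1 := by
    rw [← starRingEnd_apply, ← Circle.coe_inv_eq_conj, ← Circle.coe_mul, inv_mul_cancel,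
      Circle.coe_one]
  exact ⟨h, mul_comm (z : ℂ) _ ▸ h⟩

theorem exists_circle_neg_notMem_spectrum (A : Matrix n n ℂ) :
    ∃ z : Circle, -(z : ℂ) ∉ spectrum ℂ A := by
  have hinf : (Set.univ : Set Circle).Infinite :=
    isPreconnected_univ.infinite_of_nontrivial
      ⟨1, trivial, -1, trivial, (Circle.neg_ne_self 1).symm⟩
  have hinj : Function.Injective fun z : Circle => -(z : ℂ) :=
    neg_injective.comp Subtype.val_injective
  by_contra! h
  exact hinf ((A.finite_spectrum.preimage hinj.injOn).subset fun z _ => h z)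

/- If `-z` is not an eigenvalue of `u`, then `z⁻¹ • u` is at distance less than `2` from `1`, hence
joined to `1`; rotating the scalar joins it to `u`. -/
open scoped Matrix.Norms.L2Operator in
theorem joined_one_unitaryGroup (u : Matrix.unitaryGroup n ℂ) : Joined 1 u := by
  obtain ⟨z, hz⟩ := exists_circle_neg_notMem_spectrum (u : Matrix n n ℂ)
  let rotate (w : Circle) : Matrix.unitaryGroup n ℂ :=
    ⟨(w : ℂ) • u.1, Unitary.smul_mem_of_mem (coe_circle_mem_unitary w) u.2⟩
  have hrotate : Continuous rotate := Continuous.subtype_mk (by fun_prop) _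
  have hspec : -1 ∉ spectrum ℂ (rotate z⁻¹).1 := fun h => hz <| by
    have := (spectrum.smul_mem_smul_iff (r := Units.mk0 (z : ℂ) z.coe_ne_zero)).2 h
    simpa [rotate, Units.smul_def, smul_smul] using this
  have hone : Joined 1 (rotate z⁻¹) :=
    Unitary.joined _ _ ((Unitary.norm_sub_one_lt_two_iff (rotate z⁻¹).2).2 hspec)
  have hrotated : Joined (rotate z⁻¹) (rotate 1) := (PathConnectedSpace.joined z⁻¹ 1).map hrotate
  have hu : rotate 1 = u := Subtype.ext (by simp [rotate])
  exact hone.trans (hu ▸ hrotated)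

instance : PathConnectedSpace (Matrix.unitaryGroup n ℂ) :=
  ⟨⟨1⟩, fun u v => (joined_one_unitaryGroup u).symm.trans (joined_one_unitaryGroup v)⟩

/-- The retraction of `U(n)` onto `SU(n)` that divides the column `i` by the determinant. -/
noncomputable def divColumnDet (i : n) (u : Matrix.unitaryGroup n ℂ) :
    Matrix.specialUnitaryGroup n ℂ :=
  ⟨u.1 * Matrix.diagonal (Function.update 1 i (star u.1.det)), by
    have hdet := Matrix.det_of_mem_unitary u.2
    refine Matrix.mem_specialUnitaryGroup_iff.2 ⟨mul_mem u.2 ?_, ?_⟩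
    · rw [Matrix.mem_unitaryGroup_iff, Matrix.star_eq_conjTranspose,
        Matrix.diagonal_conjTranspose, Matrix.diagonal_mul_diagonal, ← Matrix.diagonal_one]
      congr 1
      funext j
      rcases eq_or_ne j i with rfl | hj
      · simpa using hdet.1
      · simp [hj]
    · simpa [Matrix.det_mul, Matrix.det_diagonal, Finset.prod_update_of_mem] using hdet.2⟩

theorem continuous_divColumnDet (i : n) : Continuous (divColumnDet i) :=
  Continuous.subtype_mk (continuous_subtype_val.matrix_mul <| Continuous.matrix_diagonal <|
    continuous_const.update i continuous_subtype_val.matrix_det.star) _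

theorem surjective_divColumnDet (i : n) : Function.Surjective (divColumnDet i) := by
  intro g
  obtain ⟨hg, hdet⟩ := Matrix.mem_specialUnitaryGroup_iff.1 g.2
  refine ⟨⟨g.1, hg⟩, Subtype.ext ?_⟩
  have hone : Function.update (1 : n → ℂ) i 1 = 1 := Function.update_eq_self i (1 : n → ℂ)
  simp [divColumnDet, hdet, hone]

instance [Nonempty n] : PathConnectedSpace (Matrix.specialUnitaryGroup n ℂ) :=
  (surjective_divColumnDet (Classical.arbitrary n)).pathConnectedSpace (continuous_divColumnDet _)

end SpecialUnitary

/-! ### Smooth maps into the circle -/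

section Circle

theorem contMDiff_coe_circle : ContMDiff (𝓡 1) 𝓘(ℝ, ℂ) ∞ (fun z : Circle => (z : ℂ)) :=
  have : Fact (Module.finrank ℝ ℂ = 1 + 1) := finrank_real_complex_fact'
  contMDiff_coe_sphere

theorem contDiffOn_arg : ContDiffOn ℝ ∞ Complex.arg Complex.slitPlane := by
  have hlog : ContDiffOn ℝ ∞ Complex.log Complex.slitPlane := fun z hz =>
    ((Complex.contDiffAt_log hz).restrict_scalars ℝ).contDiffWithinAt
  exact (Complex.imCLM.contDiff.comp_contDiffOn hlog).congr fun z _ => (Complex.log_im z).symm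

variable {E H N : Type*} [NormedAddCommGroup E] [NormedSpace ℝ E] [TopologicalSpace H]
  {I : ModelWithCorners ℝ E H} [TopologicalSpace N] [ChartedSpace H N]

theorem contMDiffOn_circle_of_coe {f : N → Circle} {s : Set N}
    (hf : ContMDiffOn I 𝓘(ℝ, ℂ) ∞ (fun x => (f x : ℂ)) s) : ContMDiffOn I (𝓡 1) ∞ f s := by
  intro x hx
  have harg : ContDiffAt ℝ ∞ (fun w : ℂ => (((f x)⁻¹ : Circle) * w : ℂ).arg) (f x) := by
    refine ContDiffAt.comp (g := Complex.arg) _ (contDiffOn_arg.contDiffAt ?_)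
      (contDiffAt_const.mul contDiffAt_id)
    have hone : (((f x)⁻¹ : Circle) * (f x : ℂ)) = 1 := by
      rw [← Circle.coe_mul, inv_mul_cancel, Circle.coe_one]
    exact hone ▸ Complex.isOpen_slitPlane.mem_nhds Complex.one_mem_slitPlane
  have hprod : ContMDiffWithinAt I (𝓡 1) ∞
      (fun y => f x * Circle.exp (((f x)⁻¹ : Circle) * (f y : ℂ) : ℂ).arg) s x :=
    contMDiffWithinAt_const.mul <| contMDiff_circleExp.contMDiffAt.comp_contMDiffWithinAt x <|
      harg.contMDiffAt.comp_contMDiffWithinAt x (hf x hx)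
  refine hprod.congr (fun y _ => ?_) ?_ <;>
    rw [← Circle.coe_mul, Circle.exp_arg, mul_inv_cancel_left]

/-- The point of the unit circle in the direction of a complex number; it is `1` at `0`. -/
noncomputable def direction (z : ℂ) : Circle := Circle.exp z.arg

theorem norm_mul_direction (z : ℂ) : ‖z‖ * (direction z : ℂ) = z :=
  Complex.norm_mul_exp_arg_mul_I z

theorem direction_one : direction 1 = 1 := by simp [direction]

theorem direction_circle_mul (z : Circle) {w : ℂ} (hw : w ≠ 0) :
    direction (z * w) = z * direction w := by
  have hnorm := norm_mul_direction (z * w)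
  rw [norm_mul, Circle.norm_coe, one_mul] at hnorm
  refine Circle.ext (mul_left_cancel₀ (Complex.ofReal_ne_zero.2 (norm_ne_zero_iff.2 hw)) ?_)
  rw [hnorm, Circle.coe_mul, mul_left_comm, norm_mul_direction]

theorem contMDiffOn_direction : ContMDiffOn 𝓘(ℝ, ℂ) (𝓡 1) ∞ direction {0}ᶜ := by
  refine contMDiffOn_circle_of_coe (ContDiffOn.contMDiffOn ?_)
  have hne : ∀ z ∈ ({0}ᶜ : Set ℂ), ‖z‖ ≠ 0 := fun z hz => norm_ne_zero_iff.2 hz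
  have hdiv : ContDiffOn ℝ ∞ (fun z : ℂ => (‖z‖⁻¹ : ℝ) • z) {0}ᶜ :=
    ((contDiffOn_id.norm ℝ fun _ hz => hz).inv hne).smul contDiffOn_id
  refine hdiv.congr fun z hz => ?_
  rw [eq_inv_smul_iff₀ (hne z hz), Complex.real_smul, norm_mul_direction]

end Circle

/-! ### Smooth circle actions and flow boxes -/

section SmoothCircleAction

/-- A smooth action of `U(1)` on a manifold. It is a structure rather than a class because a
manifold here carries one action for each homomorphism `U(1) → SU(3)`. -/
structure SmoothCircleAction {E H : Type*} [NormedAddCommGroup E] [NormedSpace ℝ E]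
    [TopologicalSpace H] (I : ModelWithCorners ℝ E H) (N : Type*) [TopologicalSpace N]
    [ChartedSpace H N] where
  act : Circle → N → N
  one_act : ∀ x, act 1 x = x
  mul_act : ∀ z w x, act (z * w) x = act z (act w x)
  contMDiff_act : ContMDiff ((𝓡 1).prod I) I ∞ fun y : Circle × N => act y.1 y.2

namespace SmoothCircleAction

variable {E H N : Type*} [NormedAddCommGroup E] [NormedSpace ℝ E] [TopologicalSpace H]
  {I : ModelWithCorners ℝ E H} [TopologicalSpace N] [ChartedSpace H N]

instance : CoeFun (SmoothCircleAction I N) fun _ => Circle → N → N := ⟨act⟩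

variable (A : SmoothCircleAction I N)

theorem inv_act_act (z : Circle) (x : N) : A z⁻¹ (A z x) = x := by
  rw [← A.mul_act, inv_mul_cancel, A.one_act]

theorem act_inv_act (z : Circle) (x : N) : A z (A z⁻¹ x) = x := by
  rw [← A.mul_act, mul_inv_cancel, A.one_act]

theorem contMDiffOn_comp {E' H' N' : Type*} [NormedAddCommGroup E'] [NormedSpace ℝ E']
    [TopologicalSpace H'] {J : ModelWithCorners ℝ E' H'} [TopologicalSpace N'] [ChartedSpace H' N']
    {f : N' → Circle} {g : N' → N} {s : Set N'} (hf : ContMDiffOn J (𝓡 1) ∞ f s)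
    (hg : ContMDiffOn J I ∞ g s) : ContMDiffOn J I ∞ (fun y => A (f y) (g y)) s :=
  A.contMDiff_act.comp_contMDiffOn (hf.prodMk hg)

theorem continuous_act (z : Circle) : Continuous (A z) :=
  A.contMDiff_act.continuous.comp (by fun_prop : Continuous fun x : N => (z, x))

theorem isClosed_inter_setOf_exists_act_eq [T2Space N] {X : Type*} [TopologicalSpace X]
    {C : Set (X × N)} (hC : IsClosed C) {τ : X → N} (hτ : ContinuousOn τ (Prod.fst '' C)) :
    IsClosed (C ∩ {c | ∃ z, c.2 = A z (τ c.1)}) := by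
  have hcont : ContinuousOn (fun y : Circle × X × N => (y.2.2, A y.1 (τ y.2.1)))
      (Prod.snd ⁻¹' C) := by
    have hpair : ContinuousOn (fun y : Circle × X × N => (y.1, τ y.2.1)) (Prod.snd ⁻¹' C) :=
      continuous_fst.continuousOn.prodMk <|
        hτ.comp continuous_snd.fst.continuousOn fun y hy => Set.mem_image_of_mem _ hy
    exact continuous_snd.snd.continuousOn.prodMk
      (A.contMDiff_act.continuous.comp_continuousOn hpair)
  have hclosed := isClosedMap_snd_of_compactSpace _ <|
    hcont.preimage_isClosed_of_isClosed (hC.preimage continuous_snd) isClosed_diagonal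
  convert hclosed using 1
  ext c
  exact ⟨fun ⟨hc, z, hz⟩ => ⟨(z, c), ⟨hc, hz⟩, rfl⟩, fun ⟨y, ⟨hc, hz⟩, h⟩ => h ▸ ⟨hc, y.1, hz⟩⟩

end SmoothCircleAction

end SmoothCircleAction

section Straightening

theorem exists_openPartialHomeomorph_contDiffOn_symm {E F : Type*} [NormedAddCommGroup E]
    [NormedSpace ℝ E] [NormedAddCommGroup F] [NormedSpace ℝ F] [CompleteSpace E]
    {f : E → F} {U : Set E} (hU : IsOpen U) (hf : ContDiffOn ℝ ∞ f U) {a : E} (ha : a ∈ U)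
    {L : E ≃L[ℝ] F} (hL : HasFDerivAt f (L : E →L[ℝ] F) a) :
    ∃ e : OpenPartialHomeomorph E F, ⇑e = f ∧ a ∈ e.source ∧ e.source ⊆ U ∧
      ContDiffOn ℝ ∞ e.symm e.target := by
  have hfa : ContDiffAt ℝ ∞ f a := hf.contDiffAt (hU.mem_nhds ha)
  let W : Set E := U ∩ fderiv ℝ f ⁻¹' Set.range ((↑) : (E ≃L[ℝ] F) → (E →L[ℝ] F))
  have hW : IsOpen W :=
    (hf.continuousOn_fderiv_of_isOpen hU (by simp)).isOpen_inter_preimage hU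
      ContinuousLinearEquiv.isOpen
  let e := (hfa.toOpenPartialHomeomorph f hL (by simp)).restr W
  have hsource : e.source = (hfa.toOpenPartialHomeomorph f hL (by simp)).source ∩ W := by
    rw [OpenPartialHomeomorph.restr_source, hW.interior_eq]
  refine ⟨e, rfl, ?_, fun x hx => (hsource ▸ hx).2.1, fun y hy => ?_⟩
  · rw [hsource]
    exact ⟨hfa.mem_toOpenPartialHomeomorph_source hL (by simp), ha, L, hL.fderiv.symm⟩
  · obtain ⟨-, hyU, L', hL'⟩ := hsource ▸ e.map_target hy
    have hfy : ContDiffAt ℝ ∞ f (e.symm y) := hf.contDiffAt (hU.mem_nhds hyU)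
    refine (e.contDiffAt_symm hy (f₀' := L') ?_ hfy).contDiffWithinAt
    rw [hL']
    exact (hfy.differentiableAt (by simp)).hasFDerivAt

variable {E B : Type*} [NormedAddCommGroup E] [NormedSpace ℝ E] [FiniteDimensional ℝ E]
  [NormedAddCommGroup B] [NormedSpace ℝ B] [FiniteDimensional ℝ B]

theorem exists_continuousLinearEquiv_fst_eq
    (hdim : Module.finrank ℝ E = Module.finrank ℝ B + 1) {l : E →L[ℝ] ℝ} (hl : l ≠ 0) :
    ∃ L : E ≃L[ℝ] ℝ × B, ∀ v, (L v).1 = l v := by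
  obtain ⟨w, hw⟩ : ∃ w, l w = 1 := by
    obtain ⟨v, hv⟩ := DFunLike.ne_iff.1 hl
    exact ⟨(l v)⁻¹ • v, by simpa using inv_mul_cancel₀ hv⟩
  let P : E →ₗ[ℝ] l.ker := (LinearMap.id - (l : E →ₗ[ℝ] ℝ).smulRight w).codRestrict l.ker
    fun v => by simp [hw]
  have hker : Module.finrank ℝ l.ker = Module.finrank ℝ B := by
    have hrange : (l : E →ₗ[ℝ] ℝ).range = ⊤ := LinearMap.range_eq_top.2 fun r =>
      ⟨r • w, by simp [hw]⟩
    have := (l : E →ₗ[ℝ] ℝ).finrank_range_add_finrank_ker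
    rw [hrange, finrank_top, Module.finrank_self] at this
    exact Nat.add_left_cancel (this.trans (hdim.trans (add_comm _ _)))
  let e : l.ker ≃ₗ[ℝ] B := LinearEquiv.ofFinrankEq _ _ hker
  have hinj : Function.Injective ((l : E →ₗ[ℝ] ℝ).prod (e.toLinearMap ∘ₗ P)) := by
    refine (injective_iff_map_eq_zero _).2 fun v hv => ?_
    obtain ⟨hlv, hPv⟩ := Prod.mk_eq_zero.1 hv
    have hv : v - l v • w = 0 := congrArg Subtype.val (e.map_eq_zero_iff.1 hPv)
    simpa [show l v = 0 from hlv] using hv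
  refine ⟨(LinearMap.linearEquivOfInjective _ hinj ?_).toContinuousLinearEquiv, fun v => rfl⟩
  rw [Module.finrank_prod, Module.finrank_self, hdim, add_comm]

theorem exists_openPartialHomeomorph_fst_eq
    (hdim : Module.finrank ℝ E = Module.finrank ℝ B + 1) {f : E → ℝ} {U : Set E} (hU : IsOpen U)
    (hf : ContDiffOn ℝ ∞ f U) {a : E} (ha : a ∈ U) (hderiv : fderiv ℝ f a ≠ 0) :
    ∃ e : OpenPartialHomeomorph E (ℝ × B), a ∈ e.source ∧ e.source ⊆ U ∧
      (∀ y, (e y).1 = f y) ∧ ContDiffOn ℝ ∞ e e.source ∧ ContDiffOn ℝ ∞ e.symm e.target := by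
  obtain ⟨L, hL⟩ := exists_continuousLinearEquiv_fst_eq (B := B) hdim hderiv
  have hsnd : ContDiff ℝ ∞ fun y => (L y).2 := L.contDiff.snd
  have hL' : HasFDerivAt (fun y => (f y, (L y).2)) (L : E →L[ℝ] ℝ × B) a := by
    have hfst : HasFDerivAt f (fderiv ℝ f a) a :=
      ((hf.contDiffAt (hU.mem_nhds ha)).differentiableAt (by simp)).hasFDerivAt
    have hprod : (L : E →L[ℝ] ℝ × B) = (fderiv ℝ f a).prod
        ((ContinuousLinearMap.snd ℝ ℝ B).comp (L : E →L[ℝ] ℝ × B)) :=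
      ContinuousLinearMap.ext fun v => Prod.ext (hL v) rfl
    rw [hprod]
    exact hfst.prodMk (L : E →L[ℝ] ℝ × B).hasFDerivAt.snd
  obtain ⟨e, he, hae, heU, hsymm⟩ :=
    exists_openPartialHomeomorph_contDiffOn_symm hU (hf.prodMk hsnd.contDiffOn) ha hL'
  refine ⟨e, hae, heU, fun y => by rw [he], ?_, hsymm⟩
  rw [he]
  exact (hf.prodMk hsnd.contDiffOn).mono heU

theorem exists_chart_fst_eq {N : Type*} [TopologicalSpace N] [ChartedSpace E N]
    [IsManifold 𝓘(ℝ, E) ∞ N] (hdim : Module.finrank ℝ E = Module.finrank ℝ B + 1)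
    {f : N → ℝ} {U : Set N} (hU : IsOpen U) (hf : ContMDiffOn 𝓘(ℝ, E) 𝓘(ℝ) ∞ f U) {x : N}
    (hx : x ∈ U) (hderiv : mfderiv 𝓘(ℝ, E) 𝓘(ℝ) f x ≠ 0) :
    ∃ D : OpenPartialHomeomorph N (ℝ × B), x ∈ D.source ∧ D.source ⊆ U ∧
      (∀ y ∈ D.source, (D y).1 = f y) ∧ ContMDiffOn 𝓘(ℝ, E) 𝓘(ℝ, ℝ × B) ∞ D D.source ∧
      ContMDiffOn 𝓘(ℝ, ℝ × B) 𝓘(ℝ, E) ∞ D.symm D.target := by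
  let φ := chartAt E x
  have hφ : ContMDiffOn 𝓘(ℝ, E) 𝓘(ℝ, E) ∞ φ φ.source := contMDiffOn_chart
  have hφ' : ContMDiffOn 𝓘(ℝ, E) 𝓘(ℝ, E) ∞ φ.symm φ.target := contMDiffOn_chart_symm
  have hV : IsOpen (φ.target ∩ φ.symm ⁻¹' U) := φ.symm.isOpen_inter_preimage hU
  have hfφ : ContDiffOn ℝ ∞ (f ∘ φ.symm) (φ.target ∩ φ.symm ⁻¹' U) :=
    contMDiffOn_iff_contDiffOn.1 <|
      hf.comp (hφ'.mono Set.inter_subset_left) fun _ hy => hy.2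
  have hxφ : x ∈ φ.source := mem_chart_source E x
  have hderiv' : fderiv ℝ (f ∘ φ.symm) (φ x) ≠ 0 := by
    have hfx := (hf.contMDiffAt (hU.mem_nhds hx)).mdifferentiableAt (by simp)
    rwa [hfx.mfderiv, ModelWithCorners.range_eq_univ, fderivWithin_univ] at hderiv
  obtain ⟨e, hae, heV, hef, hsmooth, hsymm⟩ := exists_openPartialHomeomorph_fst_eq (B := B) hdim hV
    hfφ ⟨φ.map_source hxφ, by rwa [Set.mem_preimage, φ.left_inv hxφ]⟩ hderiv'
  refine ⟨φ ≫ₕ e, ⟨hxφ, hae⟩, fun y hy => ?_, fun y hy => ?_, ?_, ?_⟩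
  · simpa [φ.left_inv hy.1] using (heV hy.2).2
  · exact (hef (φ y)).trans (congrArg f (φ.left_inv hy.1))
  · exact hsmooth.contMDiffOn.comp (hφ.mono fun y hy => hy.1) fun y hy => hy.2
  · exact hφ'.comp (hsymm.contMDiffOn.mono fun y hy => hy.1) fun y hy => hy.2

end Straightening

section FlowBox

variable {E H N : Type*} [NormedAddCommGroup E] [NormedSpace ℝ E] [TopologicalSpace H]
  {I : ModelWithCorners ℝ E H} [TopologicalSpace N] [ChartedSpace H N]

/-- A smooth map from an invariant open set to `U(1)` that is equivariant for a circle action and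
for the translations of `U(1)`. -/
structure CirclePhase (A : SmoothCircleAction I N) where
  source : Set N
  phase : N → Circle
  isOpen_source : IsOpen source
  act_mem : ∀ {x}, x ∈ source → ∀ z, A z x ∈ source
  phase_act : ∀ {x}, x ∈ source → ∀ z, phase (A z x) = z * phase x
  contMDiffOn_phase : ContMDiffOn I (𝓡 1) ∞ phase source

namespace CirclePhase

variable {A : SmoothCircleAction I N} (P : CirclePhase A)

/-- The projection along the orbits onto the slice where the phase is `1`. -/
noncomputable def retract (x : N) : N := A (P.phase x)⁻¹ x

theorem act_phase_retract (x : N) : A (P.phase x) (P.retract x) = x := A.act_inv_act _ x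

theorem phase_retract {x : N} (hx : x ∈ P.source) : P.phase (P.retract x) = 1 := by
  rw [retract, P.phase_act hx, inv_mul_cancel]

theorem retract_eq_self {x : N} (hx : P.phase x = 1) : P.retract x = x := by
  rw [retract, hx, inv_one, A.one_act]

theorem retract_act {x : N} (hx : x ∈ P.source) (z : Circle) :
    P.retract (A z x) = P.retract x := by
  rw [retract, P.phase_act hx, mul_inv_rev, A.mul_act, A.inv_act_act, retract]

theorem contMDiffOn_retract : ContMDiffOn I I ∞ P.retract P.source :=
  A.contMDiffOn_comp P.contMDiffOn_phase.inv contMDiffOn_id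

theorem isOpen_preimage_slitPlane :
    IsOpen (P.source ∩ (fun x => (P.phase x : ℂ)) ⁻¹' Complex.slitPlane) :=
  (contMDiff_coe_circle.comp_contMDiffOn P.contMDiffOn_phase).continuousOn.isOpen_inter_preimage
    P.isOpen_source Complex.isOpen_slitPlane

theorem contMDiffOn_arg_phase : ContMDiffOn I 𝓘(ℝ) ∞ (fun x => (P.phase x : ℂ).arg)
    (P.source ∩ (fun x => (P.phase x : ℂ)) ⁻¹' Complex.slitPlane) :=
  contDiffOn_arg.contMDiffOn.comp
    ((contMDiff_coe_circle.comp_contMDiffOn P.contMDiffOn_phase).mono Set.inter_subset_left)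
    fun _ hx => hx.2

theorem mem_preimage_slitPlane {x : N} (hx : x ∈ P.source) (hphase : P.phase x = 1) :
    x ∈ P.source ∩ (fun x => (P.phase x : ℂ)) ⁻¹' Complex.slitPlane :=
  ⟨hx, by rw [Set.mem_preimage, hphase]; exact Complex.one_mem_slitPlane⟩

theorem mfderiv_arg_phase_ne_zero {x : N} (hx : x ∈ P.source) (hphase : P.phase x = 1) :
    mfderiv I 𝓘(ℝ) (fun x => (P.phase x : ℂ).arg) x ≠ 0 := by
  intro hzero
  have horbit : ContMDiff 𝓘(ℝ) I ∞ fun t : ℝ => A (Circle.exp t) x :=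
    A.contMDiff_act.comp (contMDiff_circleExp.prodMk contMDiff_const)
  have hstart : A (Circle.exp 0) x = x := by rw [Circle.exp_zero, A.one_act]
  have harg : HasMFDerivAt I 𝓘(ℝ) (fun x => (P.phase x : ℂ).arg) (A (Circle.exp 0) x) 0 := by
    rw [hstart, ← hzero]
    exact ((P.contMDiffOn_arg_phase.contMDiffAt (P.isOpen_preimage_slitPlane.mem_nhds
      (P.mem_preimage_slitPlane hx hphase))).mdifferentiableAt (by simp)).hasMFDerivAt
  have hcomp := harg.comp (0 : ℝ) (horbit.mdifferentiableAt (by simp)).hasMFDerivAt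
  have hid : HasMFDerivAt 𝓘(ℝ) 𝓘(ℝ) (fun t : ℝ => t) (0 : ℝ) 0 := by
    refine (hcomp.congr_of_eventuallyEq ?_).congr_mfderiv (ContinuousLinearMap.zero_comp _)
    filter_upwards [Ioo_mem_nhds (neg_lt_zero.2 Real.pi_pos) Real.pi_pos] with t ht
    simp only [Function.comp_apply, P.phase_act hx, hphase, mul_one, Circle.arg_exp ht.1 ht.2.le]
  have hone : (0 : ℝ) = 1 :=
    congrArg (fun l : ℝ →L[ℝ] ℝ => l 1) (hasMFDerivAt_unique hid (hasMFDerivAt_id 0))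
  exact zero_ne_one hone

end CirclePhase

/-- An equivariant identification of an invariant open set with the product of an open set of a
normed space and `U(1)`. The inverse maps `(u, z)` to `A z (sec u)`. -/
structure FlowBox (A : SmoothCircleAction I N) (B : Type*) [NormedAddCommGroup B]
    [NormedSpace ℝ B] extends CirclePhase A where
  target : Set B
  coord : N → B
  sec : B → N
  isOpen_target : IsOpen target
  coord_mem : ∀ {x}, x ∈ source → coord x ∈ target
  sec_mem : ∀ {u}, u ∈ target → sec u ∈ source
  coord_act : ∀ {x}, x ∈ source → ∀ z, coord (A z x) = coord x
  coord_sec : ∀ {u}, u ∈ target → coord (sec u) = u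
  phase_sec : ∀ {u}, u ∈ target → phase (sec u) = 1
  act_phase_sec : ∀ {x}, x ∈ source → A (phase x) (sec (coord x)) = x
  contMDiffOn_coord : ContMDiffOn I 𝓘(ℝ, B) ∞ coord source
  contMDiffOn_sec : ContMDiffOn 𝓘(ℝ, B) I ∞ sec target

namespace CirclePhase

section Chart

variable {A : SmoothCircleAction I N} (P : CirclePhase A) {S : Type*} [TopologicalSpace S]
  {D : OpenPartialHomeomorph N (ℝ × S)}

theorem eq_zero_prod_of_chart (hfst : ∀ x ∈ D.source, (D x).1 = (P.phase x : ℂ).arg) {x : N}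
    (hx : x ∈ P.source) (hxD : P.retract x ∈ D.source) :
    D (P.retract x) = (0, (D (P.retract x)).2) := by
  refine Prod.ext ?_ rfl
  rw [hfst _ hxD, P.phase_retract hx, Circle.coe_one, Complex.arg_one]

theorem phase_chart_symm (hfst : ∀ x ∈ D.source, (D x).1 = (P.phase x : ℂ).arg) {u : S}
    (hu : (0, u) ∈ D.target) : P.phase (D.symm (0, u)) = 1 := by
  have harg := hfst _ (D.map_target hu)
  rw [D.right_inv hu] at harg
  rw [← Circle.exp_arg (P.phase _), ← harg, Circle.exp_zero]

theorem retract_chart_symm (hfst : ∀ x ∈ D.source, (D x).1 = (P.phase x : ℂ).arg) {u : S}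
    (hu : (0, u) ∈ D.target) : P.retract (D.symm (0, u)) = D.symm (0, u) :=
  P.retract_eq_self (P.phase_chart_symm hfst hu)

end Chart

/-- The flow box whose slice is the zero set of the first coordinate of a chart, where this
coordinate is the argument of the phase. -/
noncomputable def flowBoxOfChart {A : SmoothCircleAction I N} (P : CirclePhase A) {B : Type*}
    [NormedAddCommGroup B] [NormedSpace ℝ B] {D : OpenPartialHomeomorph N (ℝ × B)}
    (hDP : D.source ⊆ P.source)
    (hfst : ∀ x ∈ D.source, (D x).1 = (P.phase x : ℂ).arg)
    (hD : ContMDiffOn I 𝓘(ℝ, ℝ × B) ∞ D D.source)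
    (hD' : ContMDiffOn 𝓘(ℝ, ℝ × B) I ∞ D.symm D.target) : FlowBox A B where
  source := P.source ∩ P.retract ⁻¹' D.source
  phase := P.phase
  isOpen_source :=
    P.contMDiffOn_retract.continuousOn.isOpen_inter_preimage P.isOpen_source D.open_source
  act_mem hx z := ⟨P.act_mem hx.1 z, by rw [Set.mem_preimage, P.retract_act hx.1]; exact hx.2⟩
  phase_act hx := P.phase_act hx.1
  contMDiffOn_phase := P.contMDiffOn_phase.mono Set.inter_subset_left
  target := {u | ((0 : ℝ), u) ∈ D.target}
  coord x := (D (P.retract x)).2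
  sec u := D.symm (0, u)
  isOpen_target := D.open_target.preimage (Continuous.prodMk_right 0)
  coord_mem {_} hx := P.eq_zero_prod_of_chart hfst hx.1 hx.2 ▸ D.map_source hx.2
  sec_mem {_} hu := ⟨hDP (D.map_target hu), by
    rw [Set.mem_preimage, P.retract_chart_symm hfst hu]; exact D.map_target hu⟩
  coord_act hx z := by rw [P.retract_act hx.1]
  coord_sec {_} hu := by rw [P.retract_chart_symm hfst hu, D.right_inv hu]
  phase_sec hu := P.phase_chart_symm hfst hu
  act_phase_sec {_} hx := by
    rw [← P.eq_zero_prod_of_chart hfst hx.1 hx.2, D.left_inv hx.2, P.act_phase_retract]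
  contMDiffOn_coord := contDiff_snd.contMDiff.comp_contMDiffOn
    (hD.comp (P.contMDiffOn_retract.mono Set.inter_subset_left) fun _ hx => hx.2)
  contMDiffOn_sec :=
    hD'.comp (contDiff_prodMk_right (0 : ℝ)).contMDiff.contMDiffOn fun _ hu => hu

end CirclePhase

end FlowBox

section ExistsFlowBox

variable {E N B : Type*} [NormedAddCommGroup E] [NormedSpace ℝ E] [FiniteDimensional ℝ E]
  [TopologicalSpace N] [ChartedSpace E N] [IsManifold 𝓘(ℝ, E) ∞ N] [NormedAddCommGroup B]
  [NormedSpace ℝ B] [FiniteDimensional ℝ B] {A : SmoothCircleAction 𝓘(ℝ, E) N}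

theorem CirclePhase.exists_flowBox (hdim : Module.finrank ℝ E = Module.finrank ℝ B + 1)
    (P : CirclePhase A) {x₀ : N} (hx₀ : x₀ ∈ P.source) (hphase : P.phase x₀ = 1) :
    ∃ b : FlowBox A B, x₀ ∈ b.source ∧ b.phase x₀ = 1 := by
  obtain ⟨D, hx₀D, hDP, hfst, hD, hD'⟩ := exists_chart_fst_eq (B := B) hdim
    P.isOpen_preimage_slitPlane P.contMDiffOn_arg_phase (P.mem_preimage_slitPlane hx₀ hphase)
    (P.mfderiv_arg_phase_ne_zero hx₀ hphase)
  refine ⟨P.flowBoxOfChart (fun x hx => (hDP hx).1) hfst hD hD', ⟨hx₀, ?_⟩, hphase⟩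
  rwa [Set.mem_preimage, P.retract_eq_self hphase]

end ExistsFlowBox

section Assoc

variable {E H N : Type*} [NormedAddCommGroup E] [NormedSpace ℝ E] [TopologicalSpace H]
  {I : ModelWithCorners ℝ E H} [TopologicalSpace N] [ChartedSpace H N]

theorem contMDiffOn_circle_smul {F : Type*} [NormedAddCommGroup F] [NormedSpace ℝ F]
    [NormedSpace ℂ F] [IsScalarTower ℝ ℂ F] {c : N → Circle} {f : N → F} {s : Set N}
    (hc : ContMDiffOn I (𝓡 1) ∞ c s) (hf : ContMDiffOn I 𝓘(ℝ, F) ∞ f s) :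
    ContMDiffOn I 𝓘(ℝ, F) ∞ (fun x => (c x : ℂ) • f x) s :=
  (contDiff_fst.smul contDiff_snd : ContDiff ℝ ∞ fun y : ℂ × F => y.1 • y.2).contMDiff
    |>.comp_contMDiffOn ((contMDiff_coe_circle.comp_contMDiffOn hc).prodMk_space hf)

/-- The diagonal circle action on `F × N`, where `U(1)` acts on the complex normed space `F` by
scalar multiplication. -/
noncomputable def SmoothCircleAction.assoc (F : Type*) [NormedAddCommGroup F] [NormedSpace ℝ F]
    [NormedSpace ℂ F] [IsScalarTower ℝ ℂ F] (A : SmoothCircleAction I N) :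
    SmoothCircleAction (𝓘(ℝ, F).prod I) (F × N) where
  act z y := ((z : ℂ) • y.1, A z y.2)
  one_act y := by rw [Circle.coe_one, one_smul, A.one_act]
  mul_act z w y := by rw [Circle.coe_mul, mul_smul, A.mul_act]
  contMDiff_act := contMDiffOn_univ.1 <|
    (contMDiffOn_circle_smul contMDiff_fst.contMDiffOn
      (contMDiff_fst.comp contMDiff_snd).contMDiffOn).prodMk
    (A.contMDiffOn_comp contMDiff_fst.contMDiffOn (contMDiff_snd.comp contMDiff_snd).contMDiffOn)

namespace FlowBox

variable {A : SmoothCircleAction I N} {B : Type*} [NormedAddCommGroup B] [NormedSpace ℝ B]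

/-- A flow box of `N` as a flow box of `F × N`, with the coordinate in `F` transported along the
orbits to the slice. -/
noncomputable def assoc (F : Type*) [NormedAddCommGroup F] [NormedSpace ℝ F] [NormedSpace ℂ F]
    [IsScalarTower ℝ ℂ F] (b : FlowBox A B) : FlowBox (A.assoc F) (F × B) where
  source := Prod.snd ⁻¹' b.source
  phase y := b.phase y.2
  isOpen_source := b.isOpen_source.preimage continuous_snd
  act_mem hy z := b.act_mem hy z
  phase_act hy z := b.phase_act hy z
  contMDiffOn_phase := b.contMDiffOn_phase.comp contMDiff_snd.contMDiffOn fun _ hy => hy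
  target := Prod.snd ⁻¹' b.target
  coord y := (((b.phase y.2)⁻¹ : Circle) • y.1, b.coord y.2)
  sec u := (u.1, b.sec u.2)
  isOpen_target := b.isOpen_target.preimage continuous_snd
  coord_mem hy := b.coord_mem hy
  sec_mem hu := b.sec_mem hu
  coord_act {y} hy z := by
    have hphase : b.phase (A z y.2) = z * b.phase y.2 := b.phase_act hy z
    have hcoord : b.coord (A z y.2) = b.coord y.2 := b.coord_act hy z
    refine Prod.ext ?_ hcoord
    change (b.phase (A z y.2))⁻¹ • (z • y.1) = (b.phase y.2)⁻¹ • y.1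
    rw [hphase, smul_smul, mul_inv_rev, inv_mul_cancel_right]
  coord_sec {u} hu := by
    refine Prod.ext ?_ (b.coord_sec hu)
    change (b.phase (b.sec u.2))⁻¹ • u.1 = u.1
    rw [b.phase_sec hu, inv_one, one_smul]
  phase_sec hu := b.phase_sec hu
  act_phase_sec {y} hy := Prod.ext (smul_inv_smul (b.phase y.2) y.1) (b.act_phase_sec hy)
  contMDiffOn_coord :=
    (contMDiffOn_circle_smul
      (b.contMDiffOn_phase.inv.comp contMDiff_snd.contMDiffOn fun _ hy => hy)
      contMDiff_fst.contMDiffOn).prodMk_space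
    (b.contMDiffOn_coord.comp contMDiff_snd.contMDiffOn fun _ hy => hy)
  contMDiffOn_sec := contDiff_fst.contMDiff.contMDiffOn.prodMk
    (b.contMDiffOn_sec.comp contDiff_snd.contMDiff.contMDiffOn fun _ hu => hu)

/-- A flow box with its coordinate composed with a linear isomorphism. -/
noncomputable def mapCoord {B' : Type*} [NormedAddCommGroup B'] [NormedSpace ℝ B']
    (b : FlowBox A B) (L : B ≃L[ℝ] B') : FlowBox A B' where
  toCirclePhase := b.toCirclePhase
  target := L.symm ⁻¹' b.target
  coord x := L (b.coord x)
  sec u := b.sec (L.symm u)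
  isOpen_target := b.isOpen_target.preimage L.symm.continuous
  coord_mem hx := by simpa using b.coord_mem hx
  sec_mem hu := b.sec_mem hu
  coord_act hx z := by rw [b.coord_act hx]
  coord_sec hu := by rw [b.coord_sec hu, L.apply_symm_apply]
  phase_sec hu := b.phase_sec hu
  act_phase_sec hx := by rw [L.symm_apply_apply, b.act_phase_sec hx]
  contMDiffOn_coord := L.contDiff.contMDiff.comp_contMDiffOn b.contMDiffOn_coord
  contMDiffOn_sec := b.contMDiffOn_sec.comp L.symm.contDiff.contMDiff.contMDiffOn fun _ hu => hu

end FlowBox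

end Assoc

section FlowChart

variable {E H N : Type*} [NormedAddCommGroup E] [NormedSpace ℝ E] [TopologicalSpace H]
  {I : ModelWithCorners ℝ E H} [TopologicalSpace N] [ChartedSpace H N]
  {A : SmoothCircleAction I N} {B : Type*} [NormedAddCommGroup B] [NormedSpace ℝ B]
  (b : FlowBox A B)

namespace FlowBox

/-- The chart of the total space of a circle action given by a flow box, defined where the phase
is not `-1`. -/
noncomputable def flowChart : OpenPartialHomeomorph N (B × ℝ) where
  toFun x := (b.coord x, (b.phase x : ℂ).arg)
  invFun u := A (Circle.exp u.2) (b.sec u.1)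
  source := b.source ∩ (fun x => (b.phase x : ℂ)) ⁻¹' Complex.slitPlane
  target := b.target ×ˢ Set.Ioo (-Real.pi) Real.pi
  map_source' x hx := by
    refine ⟨b.coord_mem hx.1, Complex.neg_pi_lt_arg _, (Complex.arg_le_pi _).lt_of_ne ?_⟩
    exact (Complex.mem_slitPlane_iff_arg.1 hx.2).1
  map_target' u hu := by
    refine ⟨b.act_mem (b.sec_mem hu.1) _, ?_⟩
    rw [Set.mem_preimage, b.phase_act (b.sec_mem hu.1), b.phase_sec hu.1, mul_one,
      Complex.mem_slitPlane_iff_arg, Circle.arg_exp hu.2.1 hu.2.2.le]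
    exact ⟨hu.2.2.ne, Circle.coe_ne_zero _⟩
  left_inv' x hx := by rw [Circle.exp_arg, b.act_phase_sec hx.1]
  right_inv' u hu := by
    rw [b.coord_act (b.sec_mem hu.1), b.coord_sec hu.1, b.phase_act (b.sec_mem hu.1),
      b.phase_sec hu.1, mul_one, Circle.arg_exp hu.2.1 hu.2.2.le]
  open_source := b.isOpen_preimage_slitPlane
  open_target := b.isOpen_target.prod isOpen_Ioo
  continuousOn_toFun := (b.contMDiffOn_coord.continuousOn.mono Set.inter_subset_left).prodMk
    b.contMDiffOn_arg_phase.continuousOn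
  continuousOn_invFun := A.contMDiff_act.continuous.comp_continuousOn
    ((Circle.exp.continuous.comp continuous_snd).continuousOn.prodMk
      (b.contMDiffOn_sec.continuousOn.comp continuousOn_fst fun _ hu => hu.1))

theorem contMDiffOn_flowChart : ContMDiffOn I 𝓘(ℝ, B × ℝ) ∞ b.flowChart b.flowChart.source :=
  (b.contMDiffOn_coord.mono Set.inter_subset_left).prodMk_space b.contMDiffOn_arg_phase

theorem contMDiffOn_flowChart_symm :
    ContMDiffOn 𝓘(ℝ, B × ℝ) I ∞ b.flowChart.symm b.flowChart.target :=
  A.contMDiffOn_comp (contMDiff_circleExp.comp contDiff_snd.contMDiff).contMDiffOn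
    (b.contMDiffOn_sec.comp contDiff_fst.contMDiff.contMDiffOn fun _ hu => hu.1)

end FlowBox

/-- A quotient map for a circle action: a continuous open map whose fibres are orbits. -/
structure IsOrbitMap {M : Type*} [TopologicalSpace M] (A : SmoothCircleAction I N) (q : N → M) :
    Prop where
  continuous : Continuous q
  isOpenMap : IsOpenMap q
  map_eq_iff : ∀ {x y}, q x = q y ↔ ∃ z, y = A z x

namespace FlowBox

variable {M : Type*} [TopologicalSpace M] {q : N → M}

theorem mem_source_of_map_eq (hq : IsOrbitMap A q) {x y : N} (hx : x ∈ b.source)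
    (h : q x = q y) : y ∈ b.source := by
  obtain ⟨z, rfl⟩ := hq.map_eq_iff.1 h
  exact b.act_mem hx z

theorem coord_eq_of_map_eq (hq : IsOrbitMap A q) {x y : N} (hx : x ∈ b.source)
    (h : q x = q y) : b.coord x = b.coord y := by
  obtain ⟨z, rfl⟩ := hq.map_eq_iff.1 h
  exact (b.coord_act hx z).symm

theorem map_sec_coord (hq : IsOrbitMap A q) {x : N} (hx : x ∈ b.source) :
    q (b.sec (b.coord x)) = q x :=
  hq.map_eq_iff.2 ⟨_, (b.act_phase_sec hx).symm⟩

/-- The function on the orbit space induced by the coordinate of a flow box; it is `0` outside the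
image of the box. -/
noncomputable def orbitCoord (q : N → M) : M → B :=
  Function.extend (b.source.domRestrict q) (b.source.domRestrict b.coord) 0

theorem orbitCoord_map (hq : IsOrbitMap A q) {x : N} (hx : x ∈ b.source) :
    b.orbitCoord q (q x) = b.coord x :=
  Function.FactorsThrough.extend_apply (f := b.source.domRestrict q)
    (g := b.source.domRestrict b.coord) (fun y _ h => b.coord_eq_of_map_eq hq y.2 h) 0 ⟨x, hx⟩

theorem image_inter_preimage_orbitCoord (hq : IsOrbitMap A q) (O : Set B) :
    q '' b.source ∩ b.orbitCoord q ⁻¹' O = q '' (b.source ∩ b.coord ⁻¹' O) := by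
  rw [← Set.image_inter_preimage]
  refine Set.Subset.antisymm ?_ ?_ <;>
  · rintro _ ⟨x, ⟨hx, hxO⟩, rfl⟩
    refine ⟨x, ⟨hx, ?_⟩, rfl⟩
    simpa only [Set.mem_preimage, b.orbitCoord_map hq hx] using hxO

/-- The chart of the orbit space given by a flow box. -/
noncomputable def chart (hq : IsOrbitMap A q) : OpenPartialHomeomorph M B where
  toFun := b.orbitCoord q
  invFun u := q (b.sec u)
  source := q '' b.source
  target := b.target
  map_source' := by
    rintro _ ⟨x, hx, rfl⟩
    rw [b.orbitCoord_map hq hx]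
    exact b.coord_mem hx
  map_target' u hu := ⟨_, b.sec_mem hu, rfl⟩
  left_inv' := by
    rintro _ ⟨x, hx, rfl⟩
    rw [b.orbitCoord_map hq hx, b.map_sec_coord hq hx]
  right_inv' u hu := by rw [b.orbitCoord_map hq (b.sec_mem hu), b.coord_sec hu]
  open_source := hq.isOpenMap _ b.isOpen_source
  open_target := b.isOpen_target
  continuousOn_toFun := by
    refine (continuousOn_open_iff (hq.isOpenMap _ b.isOpen_source)).2 fun O hO => ?_
    rw [b.image_inter_preimage_orbitCoord hq]
    exact hq.isOpenMap _ (b.contMDiffOn_coord.continuousOn.isOpen_inter_preimage b.isOpen_source hO)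
  continuousOn_invFun := hq.continuous.comp_continuousOn b.contMDiffOn_sec.continuousOn

end FlowBox

end FlowChart

section Submersion

variable {E H N : Type*} [NormedAddCommGroup E] [NormedSpace ℝ E] [TopologicalSpace H]
  {I : ModelWithCorners ℝ E H} [TopologicalSpace N] [ChartedSpace H N] [I.Boundaryless]
  [IsManifold I ∞ N]

theorem exists_maximalAtlas_extend_eq {V : Type*} [NormedAddCommGroup V] [NormedSpace ℝ V]
    (D : OpenPartialHomeomorph N V) (hD : ContMDiffOn I 𝓘(ℝ, V) ∞ D D.source)
    (hD' : ContMDiffOn 𝓘(ℝ, V) I ∞ D.symm D.target) (L : E ≃L[ℝ] V) :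
    ∃ φ ∈ IsManifold.maximalAtlas I ∞ N, φ.source = D.source ∧
      (φ.extend I).target = L ⁻¹' D.target ∧ ∀ u, (φ.extend I).symm u = D.symm (L u) := by
  let φ : OpenPartialHomeomorph N H :=
    D ≫ₕ (L.symm.toHomeomorph.toOpenPartialHomeomorph ≫ₕ
      I.toHomeomorph.symm.toOpenPartialHomeomorph)
  have hsource : φ.source = D.source := by simp [φ]
  have htarget : φ.target = {h | L (I h) ∈ D.target} := by ext h; simp [φ]
  have hsymm : ∀ u, (φ.extend I).symm u = D.symm (L u) := fun u => by
    change D.symm (L (I (I.symm u))) = _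
    rw [I.right_inv (by simp [I.range_eq_univ])]
  refine ⟨φ, φ.mem_maximalAtlas_of_contMDiffOn ?_ ?_, hsource, ?_, hsymm⟩
  · rw [hsource]
    exact I.contMDiffOn_symm.comp (L.symm.contDiff.contMDiff.comp_contMDiffOn hD)
      fun y _ => by simp [I.range_eq_univ]
  · rw [htarget]
    exact hD'.comp (L.contDiff.contMDiff.comp I.contMDiff).contMDiffOn fun h hh => hh
  · ext u
    rw [φ.extend_target, Set.mem_inter_iff, Set.mem_preimage, htarget]
    simp [I.range_eq_univ]

theorem isSubmersionAtOfComplement_of_chart_fst {B F M : Type*} [NormedAddCommGroup B]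
    [NormedSpace ℝ B] [NormedAddCommGroup F] [NormedSpace ℝ F] [TopologicalSpace M]
    [ChartedSpace B M] {f : N → M} {x : N} (D : OpenPartialHomeomorph N (B × F))
    (hx : x ∈ D.source) (hD : ContMDiffOn I 𝓘(ℝ, B × F) ∞ D D.source)
    (hD' : ContMDiffOn 𝓘(ℝ, B × F) I ∞ D.symm D.target) (L : E ≃L[ℝ] B × F)
    {c : OpenPartialHomeomorph M B} (hc : c ∈ IsManifold.maximalAtlas 𝓘(ℝ, B) ∞ M)
    (hfc : ∀ y ∈ D.source, f y ∈ c.source ∧ c (f y) = (D y).1) :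
    Manifold.IsSubmersionAtOfComplement F I 𝓘(ℝ, B) ∞ f x := by
  obtain ⟨φ, hφ, hsource, htarget, hsymm⟩ := exists_maximalAtlas_extend_eq D hD hD' L
  refine .mk_of_charts L φ c (hsource ▸ hx) (hfc x hx).1 hφ hc ?_ fun u hu => ?_
  · exact hsource ▸ fun y hy => (hfc y hy).1
  · have hLu : L u ∈ D.target := by rwa [htarget] at hu
    change c (f ((φ.extend I).symm u)) = (L u).1
    rw [hsymm, (hfc _ (D.map_target hLu)).2, D.right_inv hLu]

end Submersion

section FlowAtlas

variable {E H N : Type*} [NormedAddCommGroup E] [NormedSpace ℝ E] [TopologicalSpace H]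
  {I : ModelWithCorners ℝ E H} [TopologicalSpace N] [ChartedSpace H N] {M : Type*}
  [TopologicalSpace M] {ι : Type*} {B : Type*} [NormedAddCommGroup B] [NormedSpace ℝ B]

/-- A presentation of `M` as a union of orbit spaces of smooth circle actions on `N` which overlap
by means of smooth maps of `N`, with a flow box around each point. It makes `M` a manifold. -/
structure FlowAtlas (A : ι → SmoothCircleAction I N) (B : Type*) [NormedAddCommGroup B]
    [NormedSpace ℝ B] (q : ι → N → M) where
  box : ∀ i : ι, N → FlowBox (A i) B
  mem_source : ∀ i x, x ∈ (box i x).source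
  phase_self : ∀ i x, (box i x).phase x = 1
  isOrbitMap : ∀ i, IsOrbitMap (A i) (q i)
  exists_map_eq : ∀ m, ∃ i x, q i x = m
  exists_transition : ∀ {i j x}, q j x ∈ Set.range (q i) → ∃ (τ : N → N) (U : Set N), IsOpen U ∧
    x ∈ U ∧ ContMDiffOn I I ∞ τ U ∧ ∀ y ∈ U, q i (τ y) = q j y

namespace FlowAtlas

variable {A : ι → SmoothCircleAction I N} {q : ι → N → M} (𝒜 : FlowAtlas A B q)

/-- The chart of `M` around `q i x` given by the flow box around `x`. -/
noncomputable def chart (i : ι) (x : N) : OpenPartialHomeomorph M B :=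
  (𝒜.box i x).chart (𝒜.isOrbitMap i)

theorem chart_map {i : ι} {x y : N} (hy : y ∈ (𝒜.box i x).source) :
    𝒜.chart i x (q i y) = (𝒜.box i x).coord y :=
  (𝒜.box i x).orbitCoord_map (𝒜.isOrbitMap i) hy

theorem mem_chart_source (i : ι) (x : N) : q i x ∈ (𝒜.chart i x).source :=
  ⟨x, 𝒜.mem_source i x, rfl⟩

theorem exists_mem_chart_source (m : M) : ∃ c : ι × N, m ∈ (𝒜.chart c.1 c.2).source := by
  obtain ⟨i, x, rfl⟩ := 𝒜.exists_map_eq m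
  exact ⟨(i, x), 𝒜.mem_chart_source i x⟩

/-- The charted space structure of `M` given by a flow atlas. -/
noncomputable abbrev chartedSpace : ChartedSpace B M where
  atlas := Set.range fun c : ι × N => 𝒜.chart c.1 c.2
  chartAt m := 𝒜.chart (𝒜.exists_mem_chart_source m).choose.1
    (𝒜.exists_mem_chart_source m).choose.2
  mem_chart_source m := (𝒜.exists_mem_chart_source m).choose_spec
  chart_mem_atlas _ := ⟨_, rfl⟩

theorem contMDiffOn_chart_comp (i j : ι) (x : N) :
    ContMDiffOn I 𝓘(ℝ, B) ∞ (𝒜.chart i x ∘ q j) (q j ⁻¹' (𝒜.chart i x).source) := by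
  rintro y ⟨y', hy', hyy'⟩
  obtain ⟨τ, U, hU, hyU, hτ, hτq⟩ := 𝒜.exists_transition ⟨y', hyy'⟩
  have hτy : τ y ∈ (𝒜.box i x).source :=
    (𝒜.box i x).mem_source_of_map_eq (𝒜.isOrbitMap i) hy' (hyy'.trans (hτq y hyU).symm)
  have hnhds : U ∩ τ ⁻¹' (𝒜.box i x).source ∈ 𝓝 y :=
    (hτ.continuousOn.isOpen_inter_preimage hU (𝒜.box i x).isOpen_source).mem_nhds ⟨hyU, hτy⟩
  have hcoord : ContMDiffOn I 𝓘(ℝ, B) ∞ ((𝒜.box i x).coord ∘ τ)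
      (U ∩ τ ⁻¹' (𝒜.box i x).source) :=
    (𝒜.box i x).contMDiffOn_coord.comp (hτ.mono Set.inter_subset_left) fun _ h => h.2
  refine ((hcoord.contMDiffAt hnhds).congr_of_eventuallyEq ?_).contMDiffWithinAt
  filter_upwards [hnhds] with w hw
  rw [Function.comp_apply, ← hτq w hw.1, 𝒜.chart_map hw.2, Function.comp_apply]

theorem contDiffOn_chart_symm_trans (c c' : ι × N) :
    ContDiffOn ℝ ∞ ((𝒜.chart c.1 c.2).symm ≫ₕ 𝒜.chart c'.1 c'.2)
      ((𝒜.chart c.1 c.2).symm ≫ₕ 𝒜.chart c'.1 c'.2).source :=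
  contMDiffOn_iff_contDiffOn.1 <| (𝒜.contMDiffOn_chart_comp c'.1 c.1 c'.2).comp
    ((𝒜.box c.1 c.2).contMDiffOn_sec.mono fun _ hu => hu.1) fun _ hu => hu.2

theorem isManifold : letI := 𝒜.chartedSpace; IsManifold 𝓘(ℝ, B) ∞ M := by
  let := 𝒜.chartedSpace
  refine isManifold_of_contDiffOn _ _ _ ?_
  rintro _ _ ⟨c, rfl⟩ ⟨c', rfl⟩
  simpa using 𝒜.contDiffOn_chart_symm_trans c c'

theorem chart_mem_maximalAtlas (i : ι) (x : N) :
    letI := 𝒜.chartedSpace; 𝒜.chart i x ∈ IsManifold.maximalAtlas 𝓘(ℝ, B) ∞ M := by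
  let := 𝒜.chartedSpace
  have := 𝒜.isManifold
  exact IsManifold.subset_maximalAtlas ⟨(i, x), rfl⟩

theorem contMDiff_map (j : ι) : letI := 𝒜.chartedSpace; ContMDiff I 𝓘(ℝ, B) ∞ (q j) := by
  let := 𝒜.chartedSpace
  have := 𝒜.isManifold
  intro x
  have hnhds : q j ⁻¹' (𝒜.chart j x).source ∈ 𝓝 x :=
    ((𝒜.chart j x).open_source.preimage (𝒜.isOrbitMap j).continuous).mem_nhds
      (𝒜.mem_chart_source j x)
  have hcomp := (contMDiffOn_symm_of_mem_maximalAtlas (𝒜.chart_mem_maximalAtlas j x)).comp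
    (𝒜.contMDiffOn_chart_comp j j x) fun y hy => (𝒜.chart j x).map_source hy
  refine (hcomp.contMDiffAt hnhds).congr_of_eventuallyEq ?_
  filter_upwards [hnhds] with y hy
  exact ((𝒜.chart j x).left_inv hy).symm

theorem exists_section (m : M) : letI := 𝒜.chartedSpace;
    ∃ (i : ι) (s : M → N) (U : Set M), IsOpen U ∧ m ∈ U ∧ ContMDiffOn 𝓘(ℝ, B) I ∞ s U ∧
      ∀ m' ∈ U, q i (s m') = m' := by
  let := 𝒜.chartedSpace
  obtain ⟨⟨i, x⟩, hm⟩ := 𝒜.exists_mem_chart_source m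
  refine ⟨i, fun m' => (𝒜.box i x).sec (𝒜.chart i x m'), (𝒜.chart i x).source,
    (𝒜.chart i x).open_source, hm, ?_, fun m' hm' => (𝒜.chart i x).left_inv hm'⟩
  exact (𝒜.box i x).contMDiffOn_sec.comp
    (contMDiffOn_of_mem_maximalAtlas (𝒜.chart_mem_maximalAtlas i x))
    fun m' hm' => (𝒜.chart i x).map_source hm'

theorem isSubmersion [I.Boundaryless] [IsManifold I ∞ N] (L : E ≃L[ℝ] B × ℝ) (j : ι) :
    letI := 𝒜.chartedSpace; Manifold.IsSubmersion I 𝓘(ℝ, B) ∞ (q j) := by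
  let := 𝒜.chartedSpace
  refine Manifold.IsSubmersionOfComplement.isSubmersion (F := ℝ) fun x => ?_
  exact isSubmersionAtOfComplement_of_chart_fst (𝒜.box j x).flowChart
    ((𝒜.box j x).mem_preimage_slitPlane (𝒜.mem_source j x) (𝒜.phase_self j x))
    (𝒜.box j x).contMDiffOn_flowChart (𝒜.box j x).contMDiffOn_flowChart_symm L
    (𝒜.chart_mem_maximalAtlas j x) fun y hy => ⟨⟨y, hy.1, rfl⟩, 𝒜.chart_map hy.1⟩

end FlowAtlas

end FlowAtlas

/-! ### Integer powers of complex numbers -/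

section SmoothPow

/-- The smooth function on `ℂ` that agrees on the unit circle with `z ↦ z ^ n`, for an integer
`n`: it is `z ^ n` if `0 ≤ n` and `conj z ^ (-n)` otherwise. -/
noncomputable def smoothPow (n : ℤ) (z : ℂ) : ℂ :=
  if 0 ≤ n then z ^ n.toNat else (Complex.conjCLE z) ^ (-n).toNat

namespace smoothPow

theorem contDiff (n : ℤ) : ContDiff ℝ ∞ (smoothPow n) := by
  unfold smoothPow
  split_ifs
  · exact contDiff_id.pow _
  · exact Complex.conjCLE.contDiff.pow _

theorem map_mul (n : ℤ) (z w : ℂ) : smoothPow n (z * w) = smoothPow n z * smoothPow n w := by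
  unfold smoothPow
  split_ifs
  · exact mul_pow _ _ _
  · rw [← mul_pow]
    simp

theorem coe_circle (n : ℤ) (z : Circle) : smoothPow n z = (z ^ n : Circle) := by
  unfold smoothPow
  split_ifs with h
  · lift n to ℕ using h
    simp
  · obtain ⟨m, rfl⟩ : ∃ m : ℕ, n = -m := ⟨(-n).toNat, by omega⟩
    rw [zpow_neg, ← inv_zpow, Circle.coe_zpow, Circle.coe_inv_eq_conj]
    simp

theorem map_one (n : ℤ) : smoothPow n 1 = 1 := by
  simpa using coe_circle n 1

theorem circle_mul (n : ℤ) (z : Circle) (w : ℂ) :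
    smoothPow n (z * w) = (z ^ n : Circle) * smoothPow n w := by
  rw [map_mul, coe_circle]

theorem eq_zero {n : ℤ} {z : ℂ} (h : smoothPow n z = 0) : z = 0 := by
  unfold smoothPow at h
  split_ifs at h
  · exact eq_zero_of_pow_eq_zero h
  · simpa using eq_zero_of_pow_eq_zero h

end smoothPow

end SmoothPow

/-! ### Equivariant maps from the punctured plane to `SU(3)` -/

section Frame

/-- The unit vector of `ℂ²` in the direction of `(x₀ ^ m, x₁ ^ n)`, where the powers are taken in
the sense of `smoothPow`; it is `0` at `x = 0` if `m` and `n` are nonzero. -/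
noncomputable def unitPowers (m n : ℤ) (x : C2) : C2 :=
  NormedSpace.normalize !₂[smoothPow m (x 0), smoothPow n (x 1)]

theorem powers_ne_zero (m n : ℤ) {x : C2} (hx : x ≠ 0) :
    !₂[smoothPow m (x 0), smoothPow n (x 1)] ≠ 0 := by
  intro h
  refine hx (PiLp.ext fun i => ?_)
  fin_cases i
  · exact smoothPow.eq_zero (congrArg (fun y : C2 => y 0) h)
  · exact smoothPow.eq_zero (congrArg (fun y : C2 => y 1) h)

theorem norm_unitPowers (m n : ℤ) {x : C2} (hx : x ≠ 0) : ‖unitPowers m n x‖ = 1 :=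
  NormedSpace.norm_normalize (powers_ne_zero m n hx)

theorem unitPowers_circle_smul (m n : ℤ) (z : Circle) (x : C2) :
    unitPowers m n ((z : ℂ) • x) =
      !₂[(z ^ m : Circle) * unitPowers m n x 0, (z ^ n : Circle) * unitPowers m n x 1] := by
  have hnorm : ‖!₂[(z ^ m : Circle) * smoothPow m (x 0), (z ^ n : Circle) * smoothPow n (x 1)]‖ =
      ‖!₂[smoothPow m (x 0), smoothPow n (x 1)]‖ := by
    simp only [EuclideanSpace.norm_eq, Fin.sum_univ_two, Matrix.cons_val_zero,
      Matrix.cons_val_one, norm_mul, Circle.norm_coe, one_mul]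
  simp only [unitPowers, NormedSpace.normalize, PiLp.smul_apply, smul_eq_mul,
    smoothPow.circle_mul, hnorm]
  ext i
  fin_cases i <;> simp [mul_left_comm]

theorem contDiffOn_unitPowers (m n : ℤ) : ContDiffOn ℝ ∞ (unitPowers m n) {0}ᶜ := by
  have hpow (k : ℤ) (i : Fin 2) : ContDiff ℝ ∞ (fun x : C2 => smoothPow k (x i)) :=
    (smoothPow.contDiff k).comp ((EuclideanSpace.proj (𝕜 := ℂ) i).contDiff.restrict_scalars ℝ)
  have hpowers : ContDiff ℝ ∞ fun x : C2 => !₂[smoothPow m (x 0), smoothPow n (x 1)] := by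
    refine contDiff_piLp' 2 fun i => ?_
    fin_cases i
    exacts [hpow m 0, hpow n 1]
  exact ((hpowers.contDiffOn.norm ℝ fun x hx => powers_ne_zero m n hx).inv
    fun x hx => norm_ne_zero_iff.2 (powers_ne_zero m n hx)).smul hpowers.contDiffOn

/-- The product of the elements of two copies of `SU(2)` in `SU(3)` which have the unit vectors
`u` and `v` as first rows. -/
noncomputable def frameMatrix (u v : C2) : Matrix (Fin 3) (Fin 3) ℂ :=
  !![u 0, u 1, 0; -(v 0 * star (u 1)), v 0 * star (u 0), v 1;
    star (u 1) * star (v 1), -(star (u 0) * star (v 1)), star (v 0)]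

theorem sum_mul_conj_of_norm_eq_one {u : C2} (hu : ‖u‖ = 1) :
    u 0 * (starRingEnd ℂ) (u 0) + u 1 * (starRingEnd ℂ) (u 1) = 1 := by
  have h := EuclideanSpace.norm_sq_eq u
  rw [hu, Fin.sum_univ_two, one_pow] at h
  rw [Complex.mul_conj', Complex.mul_conj', ← Complex.ofReal_pow, ← Complex.ofReal_pow,
    ← Complex.ofReal_add, ← h, Complex.ofReal_one]

theorem frameMatrix_mem {u v : C2} (hu : ‖u‖ = 1) (hv : ‖v‖ = 1) :
    frameMatrix u v ∈ Matrix.specialUnitaryGroup (Fin 3) ℂ := by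
  replace hu := sum_mul_conj_of_norm_eq_one hu
  replace hv := sum_mul_conj_of_norm_eq_one hv
  refine Matrix.mem_specialUnitaryGroup_iff.2 ⟨Matrix.mem_unitaryGroup_iff.2 ?_, ?_⟩
  · rw [Matrix.star_eq_conjTranspose]
    ext i j
    fin_cases i <;> fin_cases j <;>
      simp [frameMatrix, Matrix.mul_apply, Fin.sum_univ_three]
    · linear_combination hu
    · ring
    · ring
    · ring
    · linear_combination v 0 * (starRingEnd ℂ) (v 0) * hu + hv
    · linear_combination (-v 0 * v 1) * hu
    · ring
    · linear_combination (-(starRingEnd ℂ) (v 0) * (starRingEnd ℂ) (v 1)) * hu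
    · linear_combination v 1 * (starRingEnd ℂ) (v 1) * hu + hv
  · simp only [Matrix.det_fin_three, frameMatrix, Matrix.of_apply, Matrix.cons_val,
      Complex.star_def]
    linear_combination (v 0 * (starRingEnd ℂ) (v 0) + v 1 * (starRingEnd ℂ) (v 1)) * hu + hv

theorem frameMatrix_circle_mul (z w : Circle) (u v : C2) :
    frameMatrix !₂[z * u 0, z * u 1] !₂[(z * w : Circle) * v 0, w * v 1] =
      Matrix.diagonal ![(z : ℂ), (w : ℂ), ((z * w)⁻¹ : Circle)] * frameMatrix u v := by
  have hz : (z : ℂ) * (starRingEnd ℂ) z = 1 := by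
    rw [← Circle.coe_inv_eq_conj, ← Circle.coe_mul, mul_inv_cancel, Circle.coe_one]
  ext i j
  rw [Matrix.diagonal_mul, Circle.coe_inv_eq_conj]
  fin_cases i <;> fin_cases j <;> simp [frameMatrix]
  · linear_combination (w * v 0 * (starRingEnd ℂ) (u 1)) * hz
  · linear_combination (w * v 0 * (starRingEnd ℂ) (u 0)) * hz
  · ring
  · ring

theorem contDiff_frameMatrix (i j : Fin 3) :
    ContDiff ℝ ∞ fun y : C2 × C2 => frameMatrix y.1 y.2 i j := by
  have hproj (i : Fin 2) : ContDiff ℝ ∞ fun x : C2 => x i :=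
    (EuclideanSpace.proj (𝕜 := ℂ) i).contDiff.restrict_scalars ℝ
  have hu (i : Fin 2) : ContDiff ℝ ∞ fun y : C2 × C2 => y.1 i := (hproj i).comp contDiff_fst
  have hv (i : Fin 2) : ContDiff ℝ ∞ fun y : C2 × C2 => y.2 i := (hproj i).comp contDiff_snd
  have hstar {f : C2 × C2 → ℂ} (hf : ContDiff ℝ ∞ f) : ContDiff ℝ ∞ fun y => star (f y) :=
    Complex.conjCLE.contDiff.comp hf
  unfold frameMatrix
  fin_cases i <;> fin_cases j
  · exact hu 0
  · exact hu 1
  · exact contDiff_const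
  · exact ((hv 0).mul (hstar (hu 1))).neg
  · exact (hv 0).mul (hstar (hu 0))
  · exact hv 1
  · exact (hstar (hu 1)).mul (hstar (hv 1))
  · exact ((hstar (hu 0)).mul (hstar (hv 1))).neg
  · exact hstar (hv 0)

open Classical in
/-- A smooth map from the punctured plane to `SU(3)` whose rows have the weights `p`, `q` and
`-p - q`; its value at `0` is irrelevant. -/
noncomputable def torusFrame (p q : ℤ) (x : C2) : SU3 :=
  if hx : x ≠ 0 then ⟨frameMatrix (unitPowers p p x) (unitPowers (p + q) q x),
    frameMatrix_mem (norm_unitPowers p p hx) (norm_unitPowers (p + q) q hx)⟩ else 1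

theorem coe_torusFrame {p q : ℤ} {x : C2} (hx : x ≠ 0) :
    (torusFrame p q x).1 = frameMatrix (unitPowers p p x) (unitPowers (p + q) q x) := by
  rw [torusFrame, dif_pos hx]

theorem coe_torusHom (p q : ℤ) (z : Circle) : (torusHom p q z).1 = Matrix.diagonal
    ![((z ^ p : Circle) : ℂ), ((z ^ q : Circle) : ℂ), ((z ^ (-p - q) : Circle) : ℂ)] := rfl

theorem torusFrame_circle_smul (p q : ℤ) (z : Circle) {x : C2} (hx : x ≠ 0) :
    torusFrame p q ((z : ℂ) • x) = torusHom p q z * torusFrame p q x := by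
  have hinv : z ^ (-p - q) = (z ^ p * z ^ q)⁻¹ := by
    rw [← zpow_add, ← zpow_neg, neg_add']
  refine Subtype.ext ?_
  rw [coe_torusFrame (smul_ne_zero z.coe_ne_zero hx), unitPowers_circle_smul,
    unitPowers_circle_smul, zpow_add, frameMatrix_circle_mul, ← hinv, ← coe_torusHom,
    ← coe_torusFrame hx]
  rfl

theorem SU3.contMDiffOn_of_val {E H N : Type*} [NormedAddCommGroup E] [NormedSpace ℝ E]
    [TopologicalSpace H] {I : ModelWithCorners ℝ E H} [TopologicalSpace N] [ChartedSpace H N]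
    {f : N → SU3} {s : Set N} (hf : ContMDiffOn I 𝓘(ℝ, Amb) ∞ (fun x => val (f x)) s) :
    ContMDiffOn I (𝓡 8) ∞ f s := by
  intro x hx
  rw [contMDiffWithinAt_iff_target]
  refine ⟨isInducing_val.continuousWithinAt_iff.2 (hf x hx).continuousWithinAt, ?_⟩
  exact ((contDiff_coord_mul (f x).1ᴴ).contMDiff.comp_contMDiffOn hf) x hx

theorem contMDiffOn_torusFrame (p q : ℤ) : ContMDiffOn 𝓘(ℝ, C2) (𝓡 8) ∞ (torusFrame p q) {0}ᶜ := by
  refine SU3.contMDiffOn_of_val (ContDiffOn.contMDiffOn ?_)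
  refine contDiffOn_pi.2 fun i => contDiffOn_pi.2 fun j => ?_
  exact ((contDiff_frameMatrix i j).comp_contDiffOn ((contDiffOn_unitPowers p p).prodMk
    (contDiffOn_unitPowers (p + q) q))).congr fun x hx => congrFun₂ (coe_torusFrame hx) i j

end Frame

/-! ### One-parameter subgroups acting by right translations -/

section RightMul

variable {E H G : Type*} [NormedAddCommGroup E] [NormedSpace ℝ E] [TopologicalSpace H]
  {I : ModelWithCorners ℝ E H} [TopologicalSpace G] [ChartedSpace H G] [Group G]
  [LieGroup I ∞ G] {α : Circle →* G}

/-- The action of `U(1)` on a Lie group by right translations through a smooth homomorphism. -/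
noncomputable def rightMul (hα : ContMDiff (𝓡 1) I ∞ α) : SmoothCircleAction I G where
  act z g := g * (α z)⁻¹
  one_act g := by rw [map_one, inv_one, mul_one]
  mul_act z w g := by rw [map_mul, mul_inv_rev, mul_assoc]
  contMDiff_act := contMDiff_snd.mul (hα.comp contMDiff_fst).inv

theorem rightMul_apply (hα : ContMDiff (𝓡 1) I ∞ α) (z : Circle) (g : G) :
    rightMul hα z g = g * (α z)⁻¹ := rfl

/-- The translate of a phase by left multiplication by `g₀`. -/
noncomputable def CirclePhase.leftTranslate {hα : ContMDiff (𝓡 1) I ∞ α}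
    (P : CirclePhase (rightMul hα)) (g₀ : G) : CirclePhase (rightMul hα) where
  source := (g₀⁻¹ * ·) ⁻¹' P.source
  phase g := P.phase (g₀⁻¹ * g)
  isOpen_source := P.isOpen_source.preimage (contMDiff_mul_left (I := I) (n := ∞)).continuous
  act_mem hg z := by
    rw [Set.mem_preimage, rightMul_apply, ← mul_assoc]
    exact P.act_mem hg z
  phase_act hg z := by
    rw [rightMul_apply, ← mul_assoc]
    exact P.phase_act hg z
  contMDiffOn_phase := P.contMDiffOn_phase.comp contMDiff_mul_left.contMDiffOn fun _ hg => hg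

end RightMul

section TorusHom

theorem contMDiff_torusHom (p q : ℤ) : ContMDiff (𝓡 1) (𝓡 8) ∞ (torusHom p q) := by
  have hpow (n : ℤ) : ContMDiff (𝓡 1) 𝓘(ℝ, ℂ) ∞ fun z : Circle => ((z ^ n : Circle) : ℂ) :=
    ((smoothPow.contDiff n).contMDiff.comp contMDiff_coe_circle).congr
      fun z => (smoothPow.coe_circle n z).symm
  refine SU3.contMDiff_of_val (contMDiff_pi_space.2 fun i => contMDiff_pi_space.2 fun j => ?_)
  fin_cases i <;> fin_cases j <;>
    first | exact hpow p | exact hpow q | exact hpow (-p - q) | exact contMDiff_const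

/-- A complex function on `SU(3)` on which right translation by `torusHom p q` has the weight
`m * p + n * q`. -/
noncomputable def torusWeight (m n : ℤ) (g : SU3) : ℂ :=
  smoothPow m (g.1 0 0) * smoothPow n (g.1 1 1)

theorem torusWeight_one (m n : ℤ) : torusWeight m n 1 = 1 := by
  simp [torusWeight, smoothPow.map_one]

theorem torusWeight_mul_torusHom (m n p q : ℤ) (g : SU3) (z : Circle) :
    torusWeight m n (g * torusHom p q z) = (z ^ (m * p + n * q) : Circle) * torusWeight m n g := by
  have hval : (g * torusHom p q z).1 = g.1 * (torusHom p q z).1 := rfl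
  have hentry (i : Fin 3) : (g * torusHom p q z).1 i i = (![z ^ p, z ^ q, z ^ (-p - q)] i : Circle)
      * g.1 i i := by
    rw [hval, coe_torusHom, Matrix.mul_diagonal, mul_comm]
    fin_cases i <;> rfl
  rw [torusWeight, hentry, hentry, smoothPow.circle_mul, smoothPow.circle_mul, torusWeight,
    mul_mul_mul_comm, ← Circle.coe_mul]
  simp only [Matrix.cons_val]
  rw [← zpow_mul, ← zpow_mul, ← zpow_add, mul_comm p, mul_comm q]

theorem contMDiff_torusWeight (m n : ℤ) : ContMDiff (𝓡 8) 𝓘(ℝ, ℂ) ∞ (torusWeight m n) := by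
  have hmat : ContDiff ℝ ∞ fun X : SU3.Amb => smoothPow m (X 0 0) * smoothPow n (X 1 1) :=
    ((smoothPow.contDiff m).comp (SU3.contDiff_entry 0 0)).mul
      ((smoothPow.contDiff n).comp (SU3.contDiff_entry 1 1))
  exact hmat.contMDiff.comp SU3.contMDiff_val

/-- The direction of the weight, as a phase for right translation by `torusHom p q`. -/
noncomputable def torusPhase {m n p q : ℤ} (h : m * p + n * q = -1) :
    CirclePhase (rightMul (contMDiff_torusHom p q)) where
  source := {g | torusWeight m n g ≠ 0}
  phase g := direction (torusWeight m n g)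
  isOpen_source := isOpen_ne_fun (contMDiff_torusWeight m n).continuous continuous_const
  act_mem {g} hg z := by
    change torusWeight m n _ ≠ 0
    rw [rightMul_apply, ← map_inv, torusWeight_mul_torusHom]
    exact mul_ne_zero (Circle.coe_ne_zero _) hg
  phase_act hg z := by
    rw [rightMul_apply, ← map_inv, torusWeight_mul_torusHom, h, zpow_neg_one, inv_inv,
      direction_circle_mul z hg]
  contMDiffOn_phase :=
    contMDiffOn_direction.comp (contMDiff_torusWeight m n).contMDiffOn fun _ hg => hg

/-- What the gluing construction needs to know about a homomorphism `α : U(1) → SU(3)`: flow boxes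
for the right translations by `α` around every point of `SU(3)`, and an equivariant smooth map from
the punctured plane to `SU(3)`, which trivializes the part of the tube outside its zero section. -/
structure TubeData (α : Circle →* SU3) where
  contMDiff_hom : ContMDiff (𝓡 1) (𝓡 8) ∞ α
  box : SU3 → FlowBox (rightMul contMDiff_hom) (EuclideanSpace ℝ (Fin 7))
  mem_source : ∀ g, g ∈ (box g).source
  phase_self : ∀ g, (box g).phase g = 1
  frame : C2 → SU3
  contMDiffOn_frame : ContMDiffOn 𝓘(ℝ, C2) (𝓡 8) ∞ frame {0}ᶜ
  frame_smul : ∀ (z : Circle) {x : C2}, x ≠ 0 → frame ((z : ℂ) • x) = α z * frame x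

theorem exists_tubeData {p q : ℤ} (h : IsCoprime p q) : Nonempty (TubeData (torusHom p q)) := by
  obtain ⟨m, n, hmn⟩ := h
  have hmn' : -m * p + -n * q = -1 := by rw [neg_mul, neg_mul, ← neg_add, hmn]
  have hbox (g₀ : SU3) : ∃ b : FlowBox (rightMul (contMDiff_torusHom p q))
      (EuclideanSpace ℝ (Fin 7)), g₀ ∈ b.source ∧ b.phase g₀ = 1 := by
    refine CirclePhase.exists_flowBox (by simp) ((torusPhase hmn').leftTranslate g₀) ?_ ?_
    · change torusWeight (-m) (-n) (g₀⁻¹ * g₀) ≠ 0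
      rw [inv_mul_cancel, torusWeight_one]
      exact one_ne_zero
    · change direction (torusWeight (-m) (-n) (g₀⁻¹ * g₀)) = 1
      rw [inv_mul_cancel, torusWeight_one, direction_one]
  choose box mem_source phase_self using hbox
  exact ⟨⟨contMDiff_torusHom p q, box, mem_source, phase_self, torusFrame p q,
    contMDiffOn_torusFrame p q, fun z _ hx => torusFrame_circle_smul p q z hx⟩⟩

end TorusHom

/-! ### Gluing two tubes -/

section CoordChange

/-- The change of coordinates from the `i`-th to the `j`-th of two punctured planes glued along
the inversion in the unit sphere. -/
noncomputable def coordChange (i j : Bool) (x : C2) : C2 :=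
  if i = j then x else EuclideanGeometry.inversion 0 1 x

theorem coordChange_self (i : Bool) (x : C2) : coordChange i i x = x := if_pos rfl

theorem coordChange_coordChange (i j k : Bool) (x : C2) :
    coordChange j k (coordChange i j x) = coordChange i k x := by
  cases i <;> cases j <;> cases k <;>
    simp [coordChange, EuclideanGeometry.inversion_inversion]

theorem coordChange_eq_zero {i j : Bool} {x : C2} : coordChange i j x = 0 ↔ x = 0 := by
  unfold coordChange
  split_ifs
  exacts [Iff.rfl, EuclideanGeometry.inversion_eq_center one_ne_zero]

theorem norm_coordChange_of_ne {i j : Bool} (hij : i ≠ j) (x : C2) :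
    ‖coordChange i j x‖ = ‖x‖⁻¹ := by
  rw [coordChange, if_neg hij]
  simpa using EuclideanGeometry.dist_inversion_center 0 x 1

theorem coordChange_of_norm_eq_one (i j : Bool) {x : C2} (hx : ‖x‖ = 1) :
    coordChange i j x = x := by
  unfold coordChange
  split_ifs
  exacts [rfl, EuclideanGeometry.inversion_of_mem_sphere (mem_sphere_zero_iff_norm.2 hx)]

theorem coordChange_circle_smul (i j : Bool) (z : Circle) (x : C2) :
    coordChange i j ((z : ℂ) • x) = (z : ℂ) • coordChange i j x := by
  unfold coordChange
  split_ifs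
  · rfl
  · simp only [EuclideanGeometry.inversion, dist_zero_right, norm_smul, Circle.norm_coe, one_mul,
      vsub_eq_sub, vadd_eq_add, sub_zero, add_zero, smul_comm (z : ℂ)]

theorem contDiffOn_coordChange (i j : Bool) : ContDiffOn ℝ ∞ (coordChange i j) {0}ᶜ := by
  unfold coordChange
  split_ifs
  exacts [contDiffOn_id,
    contDiffOn_const.inversion contDiffOn_const contDiffOn_id fun x hx => hx]

end CoordChange

namespace TubeData

/-- The action of `U(1)` on `ℂ² × SU(3)` whose orbits are the points of the tube around the
orbit `SU(3)/α(U(1))`. -/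
noncomputable abbrev tubeAction {α : Circle →* SU3} (T : TubeData α) :
    SmoothCircleAction (𝓘(ℝ, C2).prod (𝓡 8)) (C2 × SU3) :=
  (rightMul T.contMDiff_hom).assoc C2

theorem tubeAction_apply {α : Circle →* SU3} (T : TubeData α) (z : Circle) (a : C2 × SU3) :
    T.tubeAction z a = ((z : ℂ) • a.1, a.2 * (α z)⁻¹) := rfl

variable {α : Bool → Circle →* SU3} (D : ∀ i, TubeData (α i))

/-- The set of points of the `i`-th chart `ℂ² × SU(3)` which are identified with points of the
`j`-th chart. -/
def overlap (i j : Bool) : Set (C2 × SU3) := {a | i = j ∨ a.1 ≠ 0}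

theorem isOpen_overlap (i j : Bool) : IsOpen (overlap i j) :=
  isOpen_const.union (isOpen_ne_fun continuous_fst continuous_const)

/-- The transition map of the gluing. In the trivialization `(x, g) ↦ ([x], g * frame x)` of the
`SU(3)`-bundle outside the zero section it only changes `x`. -/
noncomputable def transition (i j : Bool) (a : C2 × SU3) : C2 × SU3 :=
  (coordChange i j a.1, a.2 * (D i).frame a.1 * ((D j).frame (coordChange i j a.1))⁻¹)

theorem transition_self (i : Bool) (a : C2 × SU3) : transition D i i a = a := by
  rw [transition, coordChange_self, mul_inv_cancel_right]

theorem transition_transition (i j k : Bool) (a : C2 × SU3) :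
    transition D j k (transition D i j a) = transition D i k a := by
  simp only [transition, coordChange_coordChange, inv_mul_cancel_right]

theorem transition_tubeAction {i j : Bool} {a : C2 × SU3} (ha : a ∈ overlap i j) (z : Circle) :
    transition D i j ((D i).tubeAction z a) = (D j).tubeAction z (transition D i j a) := by
  rcases ha with rfl | ha
  · rw [transition_self, transition_self]
  · simp only [transition, tubeAction_apply, coordChange_circle_smul, (D i).frame_smul z ha,
      (D j).frame_smul z (coordChange_eq_zero.not.2 ha), mul_inv_rev, mul_assoc,
      inv_mul_cancel_left]

theorem transition_mem_overlap {i j : Bool} (k : Bool) {a : C2 × SU3} (ha : a ∈ overlap i j)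
    (ha' : a ∈ overlap i k) : transition D i j a ∈ overlap j k := by
  rcases ha with rfl | ha
  · rwa [transition_self]
  · exact Or.inr (coordChange_eq_zero.not.2 ha)

theorem tubeAction_mem_overlap {i j : Bool} (z : Circle) {a : C2 × SU3} :
    (D i).tubeAction z a ∈ overlap i j ↔ a ∈ overlap i j :=
  or_congr_right (smul_eq_zero_iff_right z.coe_ne_zero).not

theorem contMDiffOn_transition (i j : Bool) :
    ContMDiffOn (𝓘(ℝ, C2).prod (𝓡 8)) (𝓘(ℝ, C2).prod (𝓡 8)) ∞ (transition D i j)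
      (overlap i j) := by
  rcases eq_or_ne i j with rfl | hij
  · exact contMDiffOn_id.congr fun a _ => transition_self D i a
  have hne : ∀ a ∈ overlap i j, a.1 ≠ 0 := fun a ha => ha.resolve_left hij
  have hcoord : ContMDiffOn (𝓘(ℝ, C2).prod (𝓡 8)) 𝓘(ℝ, C2) ∞
      (fun a : C2 × SU3 => coordChange i j a.1) (overlap i j) :=
    (contDiffOn_coordChange i j).contMDiffOn.comp contMDiff_fst.contMDiffOn hne
  have hframe : ContMDiffOn (𝓘(ℝ, C2).prod (𝓡 8)) (𝓡 8) ∞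
      (fun a : C2 × SU3 => (D i).frame a.1) (overlap i j) :=
    (D i).contMDiffOn_frame.comp contMDiff_fst.contMDiffOn hne
  have hframe' : ContMDiffOn (𝓘(ℝ, C2).prod (𝓡 8)) (𝓡 8) ∞
      (fun a : C2 × SU3 => (D j).frame (coordChange i j a.1)) (overlap i j) :=
    (D j).contMDiffOn_frame.comp hcoord fun a ha => coordChange_eq_zero.not.2 (hne a ha)
  exact hcoord.prodMk ((contMDiff_snd.contMDiffOn.mul hframe).mul hframe'.inv)

/-- Two points of the charts `ℂ² × SU(3)` are identified if a transition map takes one of them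
into the `U(1)`-orbit of the other. -/
def gluedSetoid : Setoid (Σ _ : Bool, C2 × SU3) where
  r a b := a.2 ∈ overlap a.1 b.1 ∧ ∃ z, b.2 = (D b.1).tubeAction z (transition D a.1 b.1 a.2)
  iseqv := by
    refine ⟨fun ⟨i, a⟩ => ⟨Or.inl rfl, 1, ?_⟩, ?_, ?_⟩
    · rw [transition_self, SmoothCircleAction.one_act]
    · rintro ⟨i, a⟩ ⟨j, b⟩ ⟨ha, z, hb⟩
      obtain rfl : b = (D j).tubeAction z (transition D i j a) := hb
      have hmem : transition D i j a ∈ overlap j i := transition_mem_overlap D i ha (Or.inl rfl)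
      refine ⟨(tubeAction_mem_overlap D z).2 hmem, z⁻¹, ?_⟩
      rw [transition_tubeAction D hmem, SmoothCircleAction.inv_act_act, transition_transition,
        transition_self]
    · rintro ⟨i, a⟩ ⟨j, b⟩ ⟨k, c⟩ ⟨ha, z, hb⟩ ⟨hb', w, hc⟩
      obtain rfl : b = (D j).tubeAction z (transition D i j a) := hb
      obtain rfl : c = (D k).tubeAction w (transition D j k _) := hc
      have hmem : transition D i j a ∈ overlap j k := (tubeAction_mem_overlap D z).1 hb'
      have ha' : transition D j i (transition D i j a) ∈ overlap i k := transition_mem_overlap D k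
        (transition_mem_overlap D i ha (Or.inl rfl)) hmem
      rw [transition_transition, transition_self] at ha'
      refine ⟨ha', w * z, ?_⟩
      rw [transition_tubeAction D hmem, transition_transition, SmoothCircleAction.mul_act]

/-- The space obtained from the two tubes `ℂ² ×_α SU(3)` by identifying the complements of their
zero sections. -/
def Glued : Type := Quotient (gluedSetoid D)

namespace Glued

instance : TopologicalSpace (Glued D) :=
  inferInstanceAs (TopologicalSpace (Quotient (gluedSetoid D)))

/-- The projection of `ℂ² × SU(3)` onto the `i`-th tube, as a map to the glued space. -/
def mk (i : Bool) (a : C2 × SU3) : Glued D := Quotient.mk (gluedSetoid D) ⟨i, a⟩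

variable {D}

theorem mk_eq_mk_iff {i j : Bool} {a b : C2 × SU3} : mk D i a = mk D j b ↔
    a ∈ overlap i j ∧ ∃ z, b = (D j).tubeAction z (transition D i j a) :=
  Quotient.eq

theorem mk_tubeAction (i : Bool) (z : Circle) (a : C2 × SU3) :
    mk D i ((D i).tubeAction z a) = mk D i a :=
  (mk_eq_mk_iff.2 ⟨Or.inl rfl, z, by rw [transition_self]⟩).symm

theorem mk_transition {i j : Bool} {a : C2 × SU3} (ha : a ∈ overlap i j) :
    mk D j (transition D i j a) = mk D i a :=
  (mk_eq_mk_iff.2 ⟨ha, 1, (SmoothCircleAction.one_act _ _).symm⟩).symm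

theorem exists_mk_eq (m : Glued D) : ∃ i a, mk D i a = m := by
  obtain ⟨⟨i, a⟩, rfl⟩ := Quotient.exists_rep m
  exact ⟨i, a, rfl⟩

theorem preimage_mk_image_mk (i j : Bool) (U : Set (C2 × SU3)) : mk D j ⁻¹' (mk D i '' U) =
    ⋃ z, overlap j i ∩ ((D i).tubeAction z ∘ transition D j i) ⁻¹' U := by
  ext b
  simp only [Set.mem_preimage, Set.mem_image, Set.mem_iUnion, Set.mem_inter_iff,
    Function.comp_apply]
  constructor
  · rintro ⟨a, ha, h⟩
    obtain ⟨hb, z, rfl⟩ := mk_eq_mk_iff.1 h.symm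
    exact ⟨z, hb, ha⟩
  · rintro ⟨z, hb, h⟩
    exact ⟨_, h, by rw [mk_tubeAction, mk_transition hb]⟩

theorem isOrbitMap_mk (i : Bool) : IsOrbitMap (D i).tubeAction (mk D i) where
  continuous := continuous_quotient_mk'.comp continuous_sigmaMk
  isOpenMap U hU := by
    refine isOpen_sigma_iff.2 fun j => ?_
    change IsOpen (mk D j ⁻¹' (mk D i '' U))
    rw [preimage_mk_image_mk]
    refine isOpen_iUnion fun z => ContinuousOn.isOpen_inter_preimage ?_ (isOpen_overlap j i) hU
    exact (SmoothCircleAction.continuous_act _ z).comp_continuousOn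
      (contMDiffOn_transition D j i).continuousOn
  map_eq_iff {a b} := by
    rw [mk_eq_mk_iff, transition_self]
    exact and_iff_right (Or.inl rfl)

instance : MulAction SU3 (Glued D) where
  smul g := Quotient.map (fun a => ⟨a.1, a.2.1, g * a.2.2⟩) fun ⟨i, a⟩ ⟨j, b⟩ ⟨ha, z, hb⟩ => by
    obtain rfl : b = (D j).tubeAction z (transition D i j a) := hb
    exact ⟨ha, z, by simp only [tubeAction_apply, transition, mul_assoc]⟩
  one_smul := by
    rintro ⟨i, a⟩
    exact congrArg (mk D i) (Prod.ext rfl (one_mul a.2))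
  mul_smul := by
    rintro g h ⟨i, a⟩
    exact congrArg (mk D i) (Prod.ext rfl (mul_assoc g h a.2))

theorem smul_mk (g : SU3) (i : Bool) (a : C2 × SU3) : g • mk D i a = mk D i (a.1, g * a.2) := rfl

end Glued

end TubeData

theorem t2Space_of_isOpenMap {M N ι : Type*} [TopologicalSpace M] [TopologicalSpace N]
    {q : ι → N → M} (hopen : ∀ i, IsOpenMap (q i)) (hsurj : ∀ m, ∃ i x, q i x = m)
    (hclosed : ∀ i j, IsClosed {c : N × N | q i c.1 = q j c.2}) : T2Space M := by
  refine (t2Space_iff M).2 fun m m' hne => ?_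
  obtain ⟨i, x, rfl⟩ := hsurj m
  obtain ⟨j, y, rfl⟩ := hsurj m'
  obtain ⟨U, V, hU, hV, hx, hy, hUV⟩ := isOpen_prod_iff.1 (hclosed i j).isOpen_compl x y hne
  refine ⟨q i '' U, q j '' V, hopen i U hU, hopen j V hV, ⟨x, hx, rfl⟩, ⟨y, hy, rfl⟩, ?_⟩
  rw [Set.disjoint_left]
  rintro _ ⟨u, hu, rfl⟩ ⟨v, hv, hvu⟩
  exact hUV (Set.mk_mem_prod hu hv) hvu.symm

namespace TubeData

variable {α : Bool → Circle →* SU3} {D : ∀ i, TubeData (α i)}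

namespace Glued

theorem norm_mul_norm_eq_one_of_mk_eq {i j : Bool} (hij : i ≠ j) {a b : C2 × SU3}
    (h : mk D i a = mk D j b) : ‖a.1‖ * ‖b.1‖ = 1 := by
  obtain ⟨ha, z, rfl⟩ := mk_eq_mk_iff.1 h
  change ‖a.1‖ * ‖(z : ℂ) • coordChange i j a.1‖ = 1
  rw [norm_smul, Circle.norm_coe, one_mul, norm_coordChange_of_ne hij,
    mul_inv_cancel₀ (norm_ne_zero_iff.2 (ha.resolve_left hij))]

theorem isClosed_setOf_mk_eq (i j : Bool) :
    IsClosed {c : (C2 × SU3) × (C2 × SU3) | mk D i c.1 = mk D j c.2} := by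
  let C : Set ((C2 × SU3) × (C2 × SU3)) := {c | i = j ∨ ‖c.1.1‖ * ‖c.2.1‖ = 1}
  have hC : IsClosed C := isClosed_const.union (isClosed_eq (by fun_prop) continuous_const)
  have hoverlap : ∀ c ∈ C, c.1 ∈ overlap i j := fun c hc =>
    hc.imp_right fun h => norm_ne_zero_iff.1 (left_ne_zero_of_mul_eq_one h)
  have hcont : ContinuousOn (transition D i j) (Prod.fst '' C) :=
    (contMDiffOn_transition D i j).continuousOn.mono (Set.image_subset_iff.2 hoverlap)
  convert (D j).tubeAction.isClosed_inter_setOf_exists_act_eq hC hcont using 1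
  ext c
  refine ⟨fun h => ⟨or_iff_not_imp_left.2 fun hij => norm_mul_norm_eq_one_of_mk_eq hij h,
    (mk_eq_mk_iff.1 h).2⟩, fun h => mk_eq_mk_iff.2 ⟨hoverlap c h.1, h.2⟩⟩

instance : T2Space (Glued D) :=
  t2Space_of_isOpenMap (fun i => (isOrbitMap_mk i).isOpenMap) exists_mk_eq isClosed_setOf_mk_eq

theorem exists_norm_le_one_mk_eq (m : Glued D) : ∃ i a, ‖a.1‖ ≤ 1 ∧ mk D i a = m := by
  obtain ⟨i, a, rfl⟩ := exists_mk_eq m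
  rcases le_total ‖a.1‖ 1 with ha | ha
  · exact ⟨i, a, ha, rfl⟩
  · have hne : a.1 ≠ 0 := norm_pos_iff.1 (zero_lt_one.trans_le ha)
    refine ⟨!i, transition D i (!i) a, ?_, mk_transition (Or.inr hne)⟩
    change ‖coordChange i (!i) a.1‖ ≤ 1
    rw [norm_coordChange_of_ne (by simp)]
    exact inv_le_one_of_one_le₀ ha

instance : CompactSpace (Glued D) := by
  have hcompact : IsCompact (⋃ i, mk D i '' (Metric.closedBall 0 1 ×ˢ Set.univ)) :=
    isCompact_iUnion fun i =>
      ((isCompact_closedBall 0 1).prod isCompact_univ).image (isOrbitMap_mk i).continuous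
  refine ⟨hcompact.of_isClosed_subset isClosed_univ fun m _ => ?_⟩
  obtain ⟨i, a, ha, rfl⟩ := exists_norm_le_one_mk_eq m
  exact Set.mem_iUnion.2 ⟨i, a, ⟨mem_closedBall_zero_iff.2 ha, trivial⟩, rfl⟩

instance : ConnectedSpace (Glued D) := by
  obtain ⟨x, hx⟩ := exists_ne (0 : C2)
  have hrange (i : Bool) : IsConnected (Set.range (mk D i)) :=
    isConnected_range (isOrbitMap_mk i).continuous
  have hinter : (Set.range (mk D true) ∩ Set.range (mk D false)).Nonempty :=
    ⟨mk D true (x, 1), ⟨_, rfl⟩, ⟨_, mk_transition (Or.inr hx)⟩⟩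
  have hunion : Set.range (mk D true) ∪ Set.range (mk D false) = Set.univ := by
    refine Set.eq_univ_of_forall fun m => ?_
    obtain ⟨i, a, rfl⟩ := exists_mk_eq m
    cases i
    exacts [Or.inr ⟨a, rfl⟩, Or.inl ⟨a, rfl⟩]
  exact connectedSpace_iff_univ.2 (hunion ▸ (hrange true).union hinter (hrange false))

end Glued

variable (D)

/-- Linear coordinates on `ℂ² × ℝ⁷`. -/
noncomputable def tubeCoord :
    (C2 × EuclideanSpace ℝ (Fin 7)) ≃L[ℝ] EuclideanSpace ℝ (Fin 11) :=
  ContinuousLinearEquiv.ofFinrankEq (by simp [Module.finrank_prod, finrank_real_of_complex])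

/-- The flow boxes of the two tubes as an atlas of the glued space. -/
noncomputable def gluedAtlas :
    FlowAtlas (fun i => (D i).tubeAction) (EuclideanSpace ℝ (Fin 11)) (Glued.mk D) where
  box i a := (((D i).box a.2).assoc C2).mapCoord tubeCoord
  mem_source i a := (D i).mem_source a.2
  phase_self i a := (D i).phase_self a.2
  isOrbitMap := Glued.isOrbitMap_mk
  exists_map_eq := Glued.exists_mk_eq
  exists_transition {i j a} := by
    rintro ⟨b, hb⟩
    exact ⟨transition D j i, overlap j i, isOpen_overlap j i, (Glued.mk_eq_mk_iff.1 hb.symm).1,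
      contMDiffOn_transition D j i, fun _ => Glued.mk_transition⟩

namespace Glued

noncomputable instance : ChartedSpace (EuclideanSpace ℝ (Fin 11)) (Glued D) :=
  (gluedAtlas D).chartedSpace

instance : IsManifold (𝓡 11) ∞ (Glued D) := (gluedAtlas D).isManifold

variable {D}

theorem contMDiff_mk (i : Bool) : ContMDiff (𝓘(ℝ, C2).prod (𝓡 8)) (𝓡 11) ∞ (mk D i) :=
  (gluedAtlas D).contMDiff_map i

theorem isSubmersion_mk (i : Bool) :
    Manifold.IsSubmersion (𝓘(ℝ, C2).prod (𝓡 8)) (𝓡 11) ∞ (mk D i) :=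
  (gluedAtlas D).isSubmersion (ContinuousLinearEquiv.ofFinrankEq (by
    simp [Module.finrank_prod, finrank_real_of_complex])) i

instance : ContMDiffSMul (𝓡 8) (𝓡 11) ∞ SU3 (Glued D) where
  contMDiff_smul := by
    rintro ⟨g, m⟩
    obtain ⟨i, s, U, hU, hm, hs, hsU⟩ := (gluedAtlas D).exists_section m
    have hnhds : (Prod.snd : SU3 × Glued D → Glued D) ⁻¹' U ∈ 𝓝 (g, m) :=
      (hU.preimage continuous_snd).mem_nhds hm
    have hsec : ContMDiffOn ((𝓡 8).prod (𝓡 11)) (𝓘(ℝ, C2).prod (𝓡 8)) ∞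
        (fun p : SU3 × Glued D => s p.2) (Prod.snd ⁻¹' U) :=
      hs.comp contMDiff_snd.contMDiffOn fun _ hp => hp
    have hlift : ContMDiffOn ((𝓡 8).prod (𝓡 11)) (𝓘(ℝ, C2).prod (𝓡 8)) ∞
        (fun p : SU3 × Glued D => ((s p.2).1, p.1 * (s p.2).2)) (Prod.snd ⁻¹' U) :=
      (contMDiff_fst.comp_contMDiffOn hsec).prodMk
        (contMDiff_fst.contMDiffOn.mul (contMDiff_snd.comp_contMDiffOn hsec))
    refine (((contMDiff_mk i).comp_contMDiffOn hlift).contMDiffAt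
      hnhds).congr_of_eventuallyEq ?_
    filter_upwards [hnhds] with p hp
    rw [Function.comp_apply, ← smul_mk p.1 i (s p.2), hsU p.2 hp]

end Glued

end TubeData

/-! ### The zero sections -/

theorem isOrbitMap_quotientMk_range {E H G : Type*} [NormedAddCommGroup E] [NormedSpace ℝ E]
    [TopologicalSpace H] {I : ModelWithCorners ℝ E H} [TopologicalSpace G] [ChartedSpace H G]
    [Group G] [LieGroup I ∞ G] {α : Circle →* G} (hα : ContMDiff (𝓡 1) I ∞ α) :
    IsOrbitMap (rightMul hα) (QuotientGroup.mk : G → G ⧸ α.range) where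
  continuous := QuotientGroup.continuous_mk
  isOpenMap :=
    have := topologicalGroup_of_lieGroup (G := G) I ∞
    QuotientGroup.isOpenMap_coe
  map_eq_iff {g h} := by
    simp only [QuotientGroup.eq, rightMul_apply, MonoidHom.mem_range, ← map_inv,
      ← inv_mul_eq_iff_eq_mul (a := g), eq_comm (b := g⁻¹ * h)]
    exact (Equiv.inv Circle).exists_congr_left

namespace TubeData

/-- The flow boxes of right translation by `α` as an atlas of `SU(3)/α(U(1))`. -/
noncomputable def cosetAtlas {α : Circle →* SU3} (T : TubeData α) :
    FlowAtlas (fun _ : Unit => rightMul T.contMDiff_hom) (EuclideanSpace ℝ (Fin 7))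
      (fun _ => (QuotientGroup.mk : SU3 → SU3 ⧸ α.range)) where
  box _ := T.box
  mem_source _ := T.mem_source
  phase_self _ := T.phase_self
  isOrbitMap _ := isOrbitMap_quotientMk_range T.contMDiff_hom
  exists_map_eq m := ⟨(), QuotientGroup.mk_surjective m⟩
  exists_transition _ := ⟨id, Set.univ, isOpen_univ, trivial, contMDiffOn_id, fun _ _ => rfl⟩

theorem isSubmersion_quotientMk {α : Circle →* SU3} (T : TubeData α) :
    letI := T.cosetAtlas.chartedSpace
    Manifold.IsSubmersion (𝓡 8) (𝓡 7) ∞ (QuotientGroup.mk : SU3 → SU3 ⧸ α.range) :=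
  T.cosetAtlas.isSubmersion (ContinuousLinearEquiv.ofFinrankEq (by simp)) ()

variable {α : Bool → Circle →* SU3} (D : ∀ i, TubeData (α i))

namespace Glued

/-- The zero section of the `i`-th tube, as a map from the coset space. -/
noncomputable def zeroMap (i : Bool) : SU3 ⧸ (α i).range → Glued D :=
  Quotient.lift (fun g => mk D i (0, g)) fun g h hgh => by
    obtain ⟨z, rfl⟩ := (isOrbitMap_quotientMk_range (D i).contMDiff_hom).map_eq_iff.1
      (Quotient.sound hgh)
    exact (isOrbitMap_mk i).map_eq_iff.2 ⟨z, Prod.ext (smul_zero _).symm rfl⟩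

/-- The zero section of the `i`-th tube. -/
def zeroOrbit (i : Bool) : Set (Glued D) := mk D i '' {a | a.1 = 0}

variable {D}

theorem zeroMap_smul (i : Bool) (g : SU3) (w : SU3 ⧸ (α i).range) :
    zeroMap D i (g • w) = g • zeroMap D i w := by
  obtain ⟨h, rfl⟩ := QuotientGroup.mk_surjective w
  rfl

theorem range_zeroMap (i : Bool) : Set.range (zeroMap D i) = zeroOrbit D i := by
  refine Set.Subset.antisymm ?_ ?_
  · rintro _ ⟨w, rfl⟩
    obtain ⟨g, rfl⟩ := QuotientGroup.mk_surjective w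
    exact ⟨(0, g), rfl, rfl⟩
  · rintro _ ⟨⟨_, g⟩, rfl, rfl⟩
    exact ⟨g, rfl⟩

theorem zeroMap_injective (i : Bool) : Function.Injective (zeroMap D i) := by
  intro v w h
  obtain ⟨g, rfl⟩ := QuotientGroup.mk_surjective v
  obtain ⟨g', rfl⟩ := QuotientGroup.mk_surjective w
  obtain ⟨z, hz⟩ := (isOrbitMap_mk i).map_eq_iff.1 h
  exact (isOrbitMap_quotientMk_range (D i).contMDiff_hom).map_eq_iff.2 ⟨z, congrArg Prod.snd hz⟩

theorem isEmbedding_zeroMap (i : Bool) : Topology.IsEmbedding (zeroMap D i) := by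
  have hcont : Continuous (zeroMap D i) := Continuous.quotient_lift
    ((isOrbitMap_mk i).continuous.comp (continuous_const.prodMk continuous_id)) _
  exact (hcont.isClosedEmbedding (zeroMap_injective i)).isEmbedding

theorem isImmersion_zeroMap (i : Bool) : letI := (D i).cosetAtlas.chartedSpace
    Manifold.IsImmersion (𝓡 7) (𝓡 11) ∞ (zeroMap D i) := by
  let := (D i).cosetAtlas.chartedSpace
  refine Manifold.IsImmersionOfComplement.isImmersion (F := C2) fun w => ?_
  obtain ⟨g₀, rfl⟩ := QuotientGroup.mk_surjective w
  refine .mk_of_charts ((ContinuousLinearEquiv.prodComm ℝ _ _).trans tubeCoord)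
    ((D i).cosetAtlas.chart () g₀) ((gluedAtlas D).chart i (0, g₀))
    ((D i).cosetAtlas.mem_chart_source () g₀) ((gluedAtlas D).mem_chart_source i (0, g₀))
    ((D i).cosetAtlas.chart_mem_maximalAtlas () g₀)
    ((gluedAtlas D).chart_mem_maximalAtlas i (0, g₀)) ?_ fun v hv => ?_
  · rintro _ ⟨g, hg, rfl⟩
    exact ⟨(0, g), hg, rfl⟩
  · have hchart : v ∈ ((D i).cosetAtlas.chart () g₀).target := by simpa using hv
    have htarget : v ∈ ((D i).box g₀).target := hchart
    have hsource : (0, ((D i).box g₀).sec v) ∈ ((gluedAtlas D).box i (0, g₀)).source :=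
      ((D i).box g₀).sec_mem htarget
    change (gluedAtlas D).chart i (0, g₀) (mk D i (0, ((D i).box g₀).sec v)) = tubeCoord (0, v)
    rw [(gluedAtlas D).chart_map hsource]
    exact congrArg tubeCoord (Prod.ext (smul_zero _) (((D i).box g₀).coord_sec htarget))

theorem isSmoothEmbedding_zeroMap (i : Bool) : letI := (D i).cosetAtlas.chartedSpace
    Manifold.IsSmoothEmbedding (𝓡 7) (𝓡 11) ∞ (zeroMap D i) := by
  let := (D i).cosetAtlas.chartedSpace
  exact ⟨isImmersion_zeroMap i, isEmbedding_zeroMap i⟩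

end Glued

theorem isAloffWallachOrbit_zeroOrbit {p q : Bool → ℤ}
    (D : ∀ i, TubeData (torusHom (p i) (q i))) (i : Bool) :
    IsAloffWallachOrbit (p i) (q i)
      (Glued.zeroOrbit (α := fun i => torusHom (p i) (q i)) D i) := by
  refine ⟨(D i).cosetAtlas.chartedSpace, (D i).cosetAtlas.isManifold,
    (D i).isSubmersion_quotientMk, Glued.zeroMap (α := fun i => torusHom (p i) (q i)) D i,
    ?_, ?_, ?_⟩
  · exact Glued.isSmoothEmbedding_zeroMap (α := fun i => torusHom (p i) (q i)) i
  · exact Glued.zeroMap_smul (α := fun i => torusHom (p i) (q i)) i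
  · exact Glued.range_zeroMap (α := fun i => torusHom (p i) (q i)) i

end TubeData

/-! ### Orbit dimensions -/

section OrbitDim

variable {E H E' H' E'' H'' : Type*} [NormedAddCommGroup E] [NormedSpace ℝ E]
  [TopologicalSpace H] [NormedAddCommGroup E'] [NormedSpace ℝ E'] [TopologicalSpace H']
  [NormedAddCommGroup E''] [NormedSpace ℝ E''] [TopologicalSpace H'']
  {I : ModelWithCorners ℝ E H} {J : ModelWithCorners ℝ E' H'} {K : ModelWithCorners ℝ E'' H''}
  {G M N : Type*} [TopologicalSpace G] [ChartedSpace H G] [Group G]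
  [TopologicalSpace M] [ChartedSpace H' M] [MulAction G M]
  [TopologicalSpace N] [ChartedSpace H'' N]

theorem orbitDim_le_finrank [FiniteDimensional ℝ E] (m : M) :
    orbitDim I J G m ≤ Module.finrank ℝ E :=
  have : FiniteDimensional ℝ (TangentSpace I (1 : G)) := ‹FiniteDimensional ℝ E›
  LinearMap.finrank_range_le _

theorem orbitCodim_add_orbitDim [FiniteDimensional ℝ E'] (m : M) :
    orbitCodim I J G m + orbitDim I J G m = Module.finrank ℝ E' :=
  have : FiniteDimensional ℝ (TangentSpace J ((1 : G) • m)) := ‹FiniteDimensional ℝ E'›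
  Submodule.finrank_quotient_add_finrank _

theorem orbitDim_le_finrank_of_comp_eq [FiniteDimensional ℝ E''] {m : M} {k : G → N} {f : N → M}
    (hk : MDifferentiableAt I K k 1) (hf : MDifferentiableAt K J f (k 1))
    (h : f ∘ k = fun g : G => g • m) : orbitDim I J G m ≤ Module.finrank ℝ E'' := by
  let A : E'' →L[ℝ] E' := mfderiv K J f (k 1)
  let B : E →L[ℝ] E'' := mfderiv I K k 1
  have hderiv : HasMFDerivAt I J (fun g : G => g • m) 1 (A.comp B) :=
    h ▸ hf.hasMFDerivAt.comp 1 hk.hasMFDerivAt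
  rw [orbitDim, orbitTangent, hderiv.mfderiv]
  calc Module.finrank ℝ (LinearMap.range (A.comp B).toLinearMap)
      ≤ Module.finrank ℝ (LinearMap.range A.toLinearMap) :=
        Submodule.finrank_mono (LinearMap.range_comp_le_range B.toLinearMap A.toLinearMap)
    _ ≤ Module.finrank ℝ E'' := LinearMap.finrank_range_le _

theorem orbitDim_eq_finrank_of_leftInverse {m : M} {k : M → G}
    (hm : MDifferentiableAt I J (fun g : G => g • m) 1)
    (hk : MDifferentiableAt J I k ((1 : G) • m))
    (h : Function.LeftInverse k fun g : G => g • m) :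
    orbitDim I J G m = Module.finrank ℝ E := by
  have hderiv := mfderiv_comp (1 : G) hk hm
  rw [h.comp_eq_id, mfderiv_id] at hderiv
  have hinj : Function.Injective (mfderiv I J (fun g : G => g • m) 1) :=
    Function.LeftInverse.injective fun v => (DFunLike.congr_fun hderiv v).symm
  exact LinearMap.finrank_range_of_inj hinj

end OrbitDim

namespace TubeData

variable {α : Bool → Circle →* SU3} {D : ∀ i, TubeData (α i)}

namespace Glued

theorem orbitDim_mk_zero_le (i : Bool) (g₀ : SU3) :
    orbitDim (𝓡 8) (𝓡 11) SU3 (mk D i (0, g₀)) ≤ 7 := by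
  let := (D i).cosetAtlas.chartedSpace
  have horbit : ContMDiff (𝓡 8) (𝓡 7) ∞ fun g : SU3 => (↑(g * g₀) : SU3 ⧸ (α i).range) :=
    ((D i).cosetAtlas.contMDiff_map ()).comp contMDiff_mul_right
  have hzero : ContMDiff (𝓡 7) (𝓡 11) ∞ (zeroMap D i) := (isImmersion_zeroMap i).contMDiff
  have hle : orbitDim (𝓡 8) (𝓡 11) SU3 (mk D i (0, g₀)) ≤
      Module.finrank ℝ (EuclideanSpace ℝ (Fin 7)) :=
    orbitDim_le_finrank_of_comp_eq (horbit.mdifferentiableAt (by simp))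
      (hzero.mdifferentiableAt (by simp)) rfl
  simpa using hle

end Glued

/-! ### The trivialization of the complement of the singular orbits -/

namespace Glued

variable (D) in
open Classical in
/-- The equivariant retraction `[x, g] ↦ g * frame x` of the complement of the two zero sections
onto `SU(3)`, extended by `1` to the zero sections. -/
noncomputable def toSU3 : Glued D → SU3 :=
  Quotient.lift (fun a => if a.2.1 = 0 then 1 else a.2.2 * (D a.1).frame a.2.1) <| by
    rintro ⟨i, a⟩ ⟨j, b⟩ ⟨ha, z, hb⟩
    obtain rfl : b = (D j).tubeAction z (transition D i j a) := hb
    have hzero : (transition D i j a).1 = 0 ↔ a.1 = 0 := coordChange_eq_zero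
    simp only [tubeAction_apply, smul_eq_zero_iff_right z.coe_ne_zero, hzero]
    split_ifs with ha₀
    · rfl
    · rw [(D j).frame_smul z (hzero.not.2 ha₀)]
      simp only [transition, mul_assoc, inv_mul_cancel_left, inv_mul_cancel, mul_one]

theorem toSU3_mk {i : Bool} {a : C2 × SU3} (ha : a.1 ≠ 0) :
    toSU3 D (mk D i a) = a.2 * (D i).frame a.1 := if_neg ha

theorem toSU3_smul_mk (g : SU3) {i : Bool} {a : C2 × SU3} (ha : a.1 ≠ 0) :
    toSU3 D (g • mk D i a) = g * toSU3 D (mk D i a) := by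
  rw [smul_mk, toSU3_mk (a := (a.1, g * a.2)) ha, toSU3_mk ha, mul_assoc]

theorem fst_ne_zero_of_mk_eq {i j : Bool} {a b : C2 × SU3} (h : mk D i a = mk D j b)
    (ha : a.1 ≠ 0) : b.1 ≠ 0 := by
  obtain ⟨-, z, rfl⟩ := mk_eq_mk_iff.1 h
  exact smul_ne_zero z.coe_ne_zero (coordChange_eq_zero.not.2 ha)

theorem contMDiffAt_toSU3 {i : Bool} {a : C2 × SU3} (ha : a.1 ≠ 0) :
    ContMDiffAt (𝓡 11) (𝓡 8) ∞ (toSU3 D) (mk D i a) := by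
  obtain ⟨j, s, U, hU, hm, hs, hsU⟩ := (gluedAtlas D).exists_section (mk D i a)
  have hfst : ContMDiffOn (𝓡 11) 𝓘(ℝ, C2) ∞ (fun m => (s m).1) U :=
    contMDiff_fst.comp_contMDiffOn hs
  have hsnd : ContMDiffOn (𝓡 11) (𝓡 8) ∞ (fun m => (s m).2) U :=
    contMDiff_snd.comp_contMDiffOn hs
  let V : Set (Glued D) := U ∩ (fun m => (s m).1) ⁻¹' {0}ᶜ
  have hV : V ∈ 𝓝 (mk D i a) :=
    (hfst.continuousOn.isOpen_inter_preimage hU isOpen_compl_singleton).mem_nhds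
      ⟨hm, fst_ne_zero_of_mk_eq (hsU _ hm).symm ha⟩
  have hlift : ContMDiffOn (𝓡 11) (𝓡 8) ∞ (fun m => (s m).2 * (D j).frame (s m).1) V :=
    (hsnd.mono Set.inter_subset_left).mul
      ((D j).contMDiffOn_frame.comp (hfst.mono Set.inter_subset_left) fun _ hm => hm.2)
  refine (hlift.contMDiffAt hV).congr_of_eventuallyEq ?_
  filter_upwards [hV] with m hm
  rw [← toSU3_mk (i := j) hm.2, hsU m hm.1]

theorem stabilizer_mk {i : Bool} {a : C2 × SU3} (ha : a.1 ≠ 0) :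
    MulAction.stabilizer SU3 (mk D i a) = ⊥ := by
  refine (Subgroup.eq_bot_iff_forall _).2 fun g hg => ?_
  have hfixed := toSU3_smul_mk (D := D) g (i := i) ha
  rw [MulAction.mem_stabilizer_iff.1 hg] at hfixed
  exact mul_eq_right.1 hfixed.symm

theorem orbitDim_mk_of_ne_zero {i : Bool} {a : C2 × SU3} (ha : a.1 ≠ 0) :
    orbitDim (𝓡 8) (𝓡 11) SU3 (mk D i a) = 8 := by
  have horbit : ContMDiff (𝓡 8) (𝓡 11) ∞ fun g : SU3 => g • mk D i a :=
    (contMDiff_smul (n := ∞)).comp (contMDiff_id.prodMk contMDiff_const)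
  have hinverse : ContMDiffAt (𝓡 11) (𝓡 8) ∞
      (fun m => toSU3 D m * (toSU3 D (mk D i a))⁻¹) ((1 : SU3) • mk D i a) := by
    rw [one_smul]
    exact (contMDiffAt_toSU3 ha).mul contMDiffAt_const
  have hdim := orbitDim_eq_finrank_of_leftInverse (horbit.mdifferentiableAt (by simp))
    (hinverse.mdifferentiableAt (by simp)) fun g => by
      rw [toSU3_smul_mk g ha, mul_inv_cancel_right]
  simpa using hdim

end Glued

/-! ### Orbit types -/

namespace Glued

theorem orbit_mk_of_eq_zero {i : Bool} {a : C2 × SU3} (ha : a.1 = 0) :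
    MulAction.orbit SU3 (mk D i a) = zeroOrbit D i := by
  refine Set.Subset.antisymm ?_ ?_
  · rintro _ ⟨g, rfl⟩
    exact ⟨(a.1, g * a.2), ha, rfl⟩
  · rintro _ ⟨b, hb, rfl⟩
    refine ⟨b.2 * a.2⁻¹, ?_⟩
    change mk D i (a.1, b.2 * a.2⁻¹ * a.2) = mk D i b
    rw [inv_mul_cancel_right, ha, ← hb]

theorem zeroOrbit_ne : zeroOrbit D true ≠ zeroOrbit D false := by
  intro h
  obtain ⟨b, -, hb⟩ : mk D true (0, 1) ∈ zeroOrbit D false := h ▸ ⟨(0, 1), rfl, rfl⟩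
  simpa using norm_mul_norm_eq_one_of_mk_eq (by simp) hb.symm

theorem isPrincipalOrbit_mk {i : Bool} {a : C2 × SU3} (ha : a.1 ≠ 0) :
    IsPrincipalOrbit SU3 (MulAction.orbit SU3 (mk D i a)) := by
  refine ⟨mk D i a, rfl, fun m' => ⟨1, ?_⟩⟩
  rw [one_smul, stabilizer_mk ha]
  exact bot_le

theorem orbit_eq_zeroOrbit_or_isPrincipalOrbit (m : Glued D) :
    MulAction.orbit SU3 m = zeroOrbit D true ∨ MulAction.orbit SU3 m = zeroOrbit D false ∨
      IsPrincipalOrbit SU3 (MulAction.orbit SU3 m) := by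
  obtain ⟨i, a, rfl⟩ := exists_mk_eq m
  by_cases ha : a.1 = 0
  · rw [orbit_mk_of_eq_zero ha]
    cases i
    exacts [Or.inr (Or.inl rfl), Or.inl rfl]
  · exact Or.inr (Or.inr (isPrincipalOrbit_mk ha))

theorem orbitDim_le (m : Glued D) : orbitDim (𝓡 8) (𝓡 11) SU3 m ≤ 8 := by
  simpa using orbitDim_le_finrank (I := 𝓡 8) (J := 𝓡 11) (G := SU3) m

variable (D) in
theorem exists_orbitDim_eq : ∃ m : Glued D, orbitDim (𝓡 8) (𝓡 11) SU3 m = 8 := by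
  obtain ⟨x, hx⟩ := exists_ne (0 : C2)
  exact ⟨mk D true (x, 1), orbitDim_mk_of_ne_zero hx⟩

theorem isSingularOrbit_zeroOrbit (i : Bool) :
    IsSingularOrbit (𝓡 8) (𝓡 11) SU3 (zeroOrbit D i) := by
  obtain ⟨m, hm⟩ := exists_orbitDim_eq D
  refine ⟨mk D i (0, 1), (orbit_mk_of_eq_zero rfl).symm, m, ?_⟩
  rw [hm]
  exact Nat.lt_succ_of_le (orbitDim_mk_zero_le i 1)

theorem setOf_isSingularOrbit : {O : Set (Glued D) | IsSingularOrbit (𝓡 8) (𝓡 11) SU3 O} =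
    {zeroOrbit D true, zeroOrbit D false} := by
  refine Set.Subset.antisymm ?_ ?_
  · rintro _ ⟨m, rfl, m', hm'⟩
    obtain ⟨i, a, rfl⟩ := exists_mk_eq m
    by_cases ha : a.1 = 0
    · rw [orbit_mk_of_eq_zero ha]
      cases i
      exacts [Or.inr rfl, Or.inl rfl]
    · rw [orbitDim_mk_of_ne_zero ha] at hm'
      exact absurd (orbitDim_le m') hm'.not_ge
  · rintro _ (rfl | rfl)
    exacts [isSingularOrbit_zeroOrbit true, isSingularOrbit_zeroOrbit false]

theorem orbitCodim_add_orbitDim_eq (m : Glued D) :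
    orbitCodim (𝓡 8) (𝓡 11) SU3 m + orbitDim (𝓡 8) (𝓡 11) SU3 m = 11 := by
  simpa using orbitCodim_add_orbitDim (I := 𝓡 8) (J := 𝓡 11) (G := SU3) m

theorem hasCohomogeneity : HasCohomogeneity (𝓡 8) (𝓡 11) SU3 (Glued D) 3 := by
  refine ⟨?_, ?_⟩
  · obtain ⟨m, hm⟩ := exists_orbitDim_eq D
    refine ⟨m, ?_⟩
    have := orbitCodim_add_orbitDim_eq m
    change orbitCodim (𝓡 8) (𝓡 11) SU3 m = 3
    omega
  · rintro _ ⟨m, rfl⟩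
    have := orbitCodim_add_orbitDim_eq m
    have := orbitDim_le m
    change 3 ≤ orbitCodim (𝓡 8) (𝓡 11) SU3 m
    omega

end Glued

end TubeData

/-! ### The disc bundles -/

namespace TubeData

variable {α : Bool → Circle →* SU3} {D : ∀ i, TubeData (α i)}

namespace Glued

variable (D) in
/-- The inclusion of the `i`-th tube. -/
def tube (i : Bool) : AssocBundle (α i) → Glued D :=
  Quotient.lift (mk D i) fun _ _ h => (isOrbitMap_mk i).map_eq_iff.2 h

theorem tube_mk (i : Bool) (a : C2 × SU3) : tube D i (AssocBundle.mk (α i) a) = mk D i a := rfl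

theorem tube_image (i : Bool) (s : Set (C2 × SU3)) :
    tube D i '' (AssocBundle.mk (α i) '' s) = mk D i '' s := Set.image_image _ _ _

theorem tube_injective (i : Bool) : Function.Injective (tube D i) := by
  rintro ⟨a⟩ ⟨b⟩ h
  exact Quotient.sound ((isOrbitMap_mk i).map_eq_iff.1 h)

theorem tube_smul (i : Bool) (g : SU3) (b : AssocBundle (α i)) :
    tube D i (g • b) = g • tube D i b := by
  obtain ⟨a⟩ := b
  rfl

theorem isTube_tube (i : Bool) : AssocBundle.IsTube (tube D i) :=
  ⟨tube_injective i, tube_smul i, isSubmersion_mk i⟩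

theorem isEmbedding_tube (i : Bool) : Topology.IsEmbedding (tube D i) := by
  have hcont : Continuous (tube D i) := Continuous.quotient_lift (isOrbitMap_mk i).continuous _
  have hopen : IsOpenMap (tube D i) := fun U hU => by
    rw [← Set.image_preimage_eq U (Quotient.mk_surjective (s := assocSetoid (α i)))]
    exact tube_image i _ ▸ (isOrbitMap_mk i).isOpenMap _ (hU.preimage continuous_quotient_mk')
  exact (Topology.IsOpenEmbedding.of_continuous_injective_isOpenMap hcont (tube_injective i)
    hopen).isEmbedding

theorem tube_image_disc_union :
    tube D true '' AssocBundle.disc (α true) ∪ tube D false '' AssocBundle.disc (α false) =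
      Set.univ := by
  refine Set.eq_univ_of_forall fun m => ?_
  obtain ⟨i, a, ha, rfl⟩ := exists_norm_le_one_mk_eq m
  cases i
  exacts [Or.inr ⟨_, ⟨a, ha, rfl⟩, rfl⟩, Or.inl ⟨_, ⟨a, ha, rfl⟩, rfl⟩]

theorem tube_image_sphere_subset (i j : Bool) :
    tube D i '' AssocBundle.sphere (α i) ⊆ tube D j '' AssocBundle.sphere (α j) := by
  rintro _ ⟨_, ⟨a, ha, rfl⟩, rfl⟩
  have hne : a.1 ≠ 0 := norm_ne_zero_iff.1 (ha.trans_ne one_ne_zero)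
  refine ⟨_, ⟨transition D i j a, ?_, rfl⟩, mk_transition (Or.inr hne)⟩
  change ‖coordChange i j a.1‖ = 1
  rw [coordChange_of_norm_eq_one i j ha]
  exact ha

theorem tube_image_sphere (i j : Bool) :
    tube D i '' AssocBundle.sphere (α i) = tube D j '' AssocBundle.sphere (α j) :=
  (tube_image_sphere_subset i j).antisymm (tube_image_sphere_subset j i)

theorem sphere_subset_disc (β : Circle →* SU3) : AssocBundle.sphere β ⊆ AssocBundle.disc β :=
  Set.image_mono fun _ ha => le_of_eq ha

theorem tube_image_disc_inter {i j : Bool} (hij : i ≠ j) :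
    tube D i '' AssocBundle.disc (α i) ∩ tube D j '' AssocBundle.disc (α j) =
      tube D i '' AssocBundle.sphere (α i) := by
  refine Set.Subset.antisymm ?_ (Set.subset_inter (Set.image_mono (sphere_subset_disc _)) ?_)
  · rintro _ ⟨⟨_, ⟨a, ha, rfl⟩, rfl⟩, _, ⟨b, hb, rfl⟩, hba⟩
    have hmul : ‖a.1‖ * ‖b.1‖ = 1 := norm_mul_norm_eq_one_of_mk_eq hij hba.symm
    have ha₁ : 1 ≤ ‖a.1‖ := hmul ▸ mul_le_of_le_one_right (norm_nonneg _) hb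
    exact ⟨_, ⟨a, le_antisymm ha ha₁, rfl⟩, rfl⟩
  · rw [tube_image_sphere i j]
    exact Set.image_mono (sphere_subset_disc _)

variable (D) in
/-- The identification of the unit sphere bundles of the two tubes. -/
noncomputable def sphereHomeomorph (i j : Bool) :
    AssocBundle.sphere (α i) ≃ₜ AssocBundle.sphere (α j) :=
  ((isEmbedding_tube (D := D) i).homeomorphImage _).trans
    ((Homeomorph.setCongr (tube_image_sphere i j)).trans
      ((isEmbedding_tube (D := D) j).homeomorphImage _).symm)

theorem tube_sphereHomeomorph (i j : Bool) (b : AssocBundle.sphere (α i)) :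
    tube D j (sphereHomeomorph D i j b) = tube D i b :=
  congrArg Subtype.val (((isEmbedding_tube (D := D) j).homeomorphImage _).apply_symm_apply
    (Homeomorph.setCongr (tube_image_sphere i j)
      ((isEmbedding_tube (D := D) i).homeomorphImage _ b)))

theorem norm_eq_one_of_mk_mem_sphere {β : Circle →* SU3} {a : C2 × SU3}
    (ha : AssocBundle.mk β a ∈ AssocBundle.sphere β) : ‖a.1‖ = 1 := by
  obtain ⟨a', ha', h⟩ := ha
  obtain ⟨z, rfl⟩ := Quotient.exact h
  rw [norm_smul, Circle.norm_coe, one_mul]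
  exact ha'

variable (D) in
/-- The isomorphism of sphere bundles along which the disc bundles are glued. It covers the
identity because the inversion fixes the unit sphere. -/
noncomputable def sphereIso (i j : Bool) : AssocBundle.SphereIso (α i) (α j) where
  toHomeomorph := sphereHomeomorph D i j
  map_smul g b b' h := tube_injective (D := D) j <| by
    rw [tube_smul, tube_sphereHomeomorph i j b', tube_sphereHomeomorph i j b, h, tube_smul]
  covers_id b x g h := by
    have hx : ‖x‖ = 1 := norm_eq_one_of_mk_mem_sphere (a := (x, g)) (h ▸ b.2)
    have hne : x ≠ 0 := norm_ne_zero_iff.1 (hx.trans_ne one_ne_zero)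
    refine ⟨(transition D i j (x, g)).2, tube_injective (D := D) j ?_⟩
    have hfst : (transition D i j (x, g)).1 = x := coordChange_of_norm_eq_one i j hx
    calc tube D j (sphereHomeomorph D i j b) = mk D i (x, g) := by
          rw [tube_sphereHomeomorph, h, tube_mk]
      _ = mk D j (transition D i j (x, g)) := (mk_transition (Or.inr hne)).symm
      _ = mk D j (x, (transition D i j (x, g)).2) := congrArg (mk D j) (Prod.ext hfst rfl)

theorem isGluing_zeroOrbit :
    AssocBundle.IsGluing (α true) (α false) (zeroOrbit D true) (zeroOrbit D false) :=
  ⟨tube D true, tube D false, sphereIso D true false, isTube_tube true, isTube_tube false,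
    tube_image true _, tube_image false _, tube_image_disc_union, tube_image_disc_inter (by simp),
    fun b => (tube_sphereHomeomorph true false b).symm⟩

end Glued

end TubeData

theorem mainTheorem3 (p₁ p₂ q₁ q₂ : ℤ) (hp : IsCoprime p₁ p₂) (hq : IsCoprime q₁ q₂) :
    ∃ (M : Type) (_ : TopologicalSpace M) (_ : ChartedSpace (EuclideanSpace ℝ (Fin 11)) M)
      (_ : MulAction SU3 M),
      T2Space M ∧ SecondCountableTopology M ∧ CompactSpace M ∧ ConnectedSpace M ∧
      IsManifold (𝓡 11) ∞ M ∧ ContMDiffSMul (𝓡 8) (𝓡 11) ∞ SU3 M ∧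
      HasCohomogeneity (𝓡 8) (𝓡 11) SU3 M 3 ∧
      ∃ O₁ O₂ : Set M, O₁ ≠ O₂ ∧
        {O : Set M | IsSingularOrbit (𝓡 8) (𝓡 11) SU3 O} = {O₁, O₂} ∧
        (∀ m : M, MulAction.orbit SU3 m = O₁ ∨ MulAction.orbit SU3 m = O₂ ∨
          IsPrincipalOrbit SU3 (MulAction.orbit SU3 m)) ∧
        IsAloffWallachOrbit p₁ p₂ O₁ ∧ IsAloffWallachOrbit q₁ q₂ O₂ ∧
        AssocBundle.IsGluing (torusHom p₁ p₂) (torusHom q₁ q₂) O₁ O₂ := by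
  let p (i : Bool) : ℤ := cond i p₁ q₁
  let q (i : Bool) : ℤ := cond i p₂ q₂
  let α (i : Bool) : Circle →* SU3 := torusHom (p i) (q i)
  have hcoprime (i : Bool) : IsCoprime (p i) (q i) := by cases i; exacts [hq, hp]
  let D (i : Bool) : TubeData (α i) := (exists_tubeData (hcoprime i)).some
  exact ⟨TubeData.Glued D, inferInstance, inferInstance, inferInstance, inferInstance,
    ChartedSpace.secondCountable_of_sigmaCompact (EuclideanSpace ℝ (Fin 11)) _, inferInstance,
    inferInstance, inferInstance, inferInstance, TubeData.Glued.hasCohomogeneity,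
    TubeData.Glued.zeroOrbit D true, TubeData.Glued.zeroOrbit D false,
    TubeData.Glued.zeroOrbit_ne, TubeData.Glued.setOf_isSingularOrbit,
    TubeData.Glued.orbit_eq_zeroOrbit_or_isPrincipalOrbit,
    TubeData.isAloffWallachOrbit_zeroOrbit (p := p) (q := q) D true,
    TubeData.isAloffWallachOrbit_zeroOrbit (p := p) (q := q) D false,
    TubeData.Glued.isGluing_zeroOrbit (α := α) (D := D)⟩
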